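/- Let $W$ be a standard Brownian motion, $x_0>0$, and for $\rho,\sigma,\tau>0$ let $x_{i+1}=a_i x_i$ with $a_i=1+\rho e^{\sigma W(i\tau)-\frac12\sigma^2 i\tau}$. For $\rho,\beta>0$ the Lyapunov exponent $$\lambda(\rho,\beta)=\lim_{n\to\infty}\frac1n\log\mathbb E[x_n],$$ where in the $n$-th term $\sigma,\tau>0$ are such that $\frac12\sigma^2\tau n^2=\beta$ is fixed, exists. A \emph{phase} is a connected region of the parameter space $\{(\rho,\beta):\rho>0,\beta>0\}$, maximal for the condition that $\lambda$ is analytic. There is a \emph{$j$th-order phase transition} at a boundary point of a phase if at least one $j$th-order partial derivative of $\lambda$ is discontinuous there, while all partial derivatives of lower order (including $\lambda$ itself) are continuous there. Here a partial derivative is regarded as a function on the set of points where it exists, and "continuous at a point" includes that it exists at this point. For $\rho>0$ and $a>\log\rho$ put $$F(a;\rho)=\int_{\log\rho}^a\frac{dx}{\sqrt{\log\frac{1+e^a}{1+e^x}}},\qquad \rho_c=\sup\Big\{\rho>0:\ \exists\, a>\log\rho,\ \frac{\partial F}{\partial a}(a;\rho)<0\Big\}.$$ Then the set in this definition is non-empty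 and bounded above, so that $0<\rho_c<\infty$, and there are $a_c>\log\rho_c$ and $\beta_c>0$ with $$\frac{\partial F}{\partial a}(a_c;\rho_c)=0,\qquad 2\sqrt{\beta_c}=F(a_c;\rho_c).$$ For every such pair $(a_c,\beta_c)$, there is a second-order phase transition at $(\rho_c,\beta_c)$; in particular $\lambda$, $\partial_\rho\lambda$ and $\partial_\beta\lambda$ are continuous there. Moreover each of the second-order partial derivatives $\partial_\rho^2\lambda$, $\partial_\beta^2\lambda$, $\partial_\rho\partial_\beta\lambda$ and $\partial_\beta\partial_\rho\lambda$ exists at points arbitrarily close to $(\rho_c,\beta_c)$ and tends to $+\infty$ as $(\rho,\beta)\to(\rho_c,\beta_c)$ along the points where it exists. -/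

import Mathlib

open MeasureTheory ProbabilityTheory Filter Topology
open scoped NNReal

noncomputable section

/-- The random multiplicative process `x_{i+1} = a_i x_i` with constant initial value `x₀` and
multipliers `a_i = 1 + ρ exp (σ W(t_i) - σ² t_i / 2)`, where `t_i = i τ`. -/
def multProcess {Ω : Type*} (W : ℝ≥0 → Ω → ℝ) (x₀ : ℝ) (τ : ℝ≥0) (ρ σ : ℝ) : ℕ → Ω → ℝ
  | 0 => fun _ => x₀
  | i + 1 => fun ω =>
      (1 + ρ * Real.exp (σ * W (i * τ) ω - σ ^ 2 * (i * τ) / 2)) *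
        multProcess W x₀ τ ρ σ i ω

/-- `(1/n) log E[x_n]`, where `x_n` is run with time step `τ n` and with the volatility
`σ = √(2β / τ n) / n`, the positive number for which `β = σ² (τ n) n² / 2`. -/
def growthRate {Ω : Type*} [MeasurableSpace Ω] (P : Measure Ω) (W : ℝ≥0 → Ω → ℝ) (x₀ : ℝ)
    (τ : ℕ → ℝ≥0) (ρ β : ℝ) (n : ℕ) : ℝ :=
  1 / n * Real.log (∫ ω, multProcess W x₀ (τ n) ρ (√(2 * β / τ n) / n) n ω ∂P)

/-- The Lyapunov exponent `λ(ρ, β) = lim (1/n) log E[x_n]`, the limit being taken at fixed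
`β = σ² τ n² / 2`, as a function of the pair `(ρ, β)`. -/
def lyapunov {Ω : Type*} [MeasurableSpace Ω] (P : Measure Ω) (W : ℝ≥0 → Ω → ℝ) (x₀ : ℝ)
    (τ : ℕ → ℝ≥0) (p : ℝ × ℝ) : ℝ :=
  limUnder atTop (growthRate P W x₀ τ p.1 p.2)

/-- `F(a; ρ) = ∫_{log ρ}^a dx / √(log ((1 + e^a) / (1 + e^x)))`, for `a > log ρ`. -/
def critF (a ρ : ℝ) : ℝ :=
  ∫ x in Real.log ρ..a, 1 / √(Real.log ((1 + Real.exp a) / (1 + Real.exp x)))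

/-- The set of the `ρ > 0` such that `∂F/∂a (a; ρ) < 0` for some `a > log ρ`. -/
def decreasingSet : Set ℝ :=
  {ρ | 0 < ρ ∧ ∃ a, Real.log ρ < a ∧ deriv (fun a' => critF a' ρ) a < 0}

/-- The critical value `ρ_c`. -/
def rhoC : ℝ := sSup decreasingSet

/-- `a_c > log ρ_c`, `∂F/∂a (a_c; ρ_c) = 0`, `β_c > 0` and `2 √β_c = F(a_c; ρ_c)`. -/
def IsCriticalPair (a_c β_c : ℝ) : Prop :=
  Real.log rhoC < a_c ∧ HasDerivAt (fun a => critF a rhoC) 0 a_c ∧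
    0 < β_c ∧ 2 * √β_c = critF a_c rhoC

/-- The parameter space of the pairs `(ρ, β)` with `ρ > 0` and `β > 0`. -/
def paramSpace : Set (ℝ × ℝ) := {p | 0 < p.1 ∧ 0 < p.2}

/-- The coordinate directions: `0` for `ρ` and `1` for `β`. -/
def coordDir : Fin 2 → ℝ × ℝ := ![(1, 0), (0, 1)]

/-- The iterated partial derivative of `f` in the directions listed in `w`, the last entry of `w`
being applied first. It is meaningful at the points of `partialDomain f w`. -/
def iterPartial (f : ℝ × ℝ → ℝ) : List (Fin 2) → ℝ × ℝ → ℝ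
  | [] => f
  | i :: w => fun p => lineDeriv ℝ (iterPartial f w) p (coordDir i)

/-- The points of the parameter space at which the iterated partial derivative of `f` in the
directions `w` exists. -/
def partialDomain (f : ℝ × ℝ → ℝ) : List (Fin 2) → Set (ℝ × ℝ)
  | [] => paramSpace
  | i :: w => {p | (∀ᶠ t : ℝ in 𝓝 0, p + t • coordDir i ∈ partialDomain f w) ∧
      LineDifferentiableAt ℝ (iterPartial f w) p (coordDir i)}

/-- The iterated partial derivative of `f` in the directions `w` exists at `p` and is continuous
at `p` as a function on the set where it exists. -/
def PartialContinuousAt (f : ℝ × ℝ → ℝ) (w : List (Fin 2)) (p : ℝ × ℝ) : Prop :=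
  p ∈ partialDomain f w ∧ ContinuousWithinAt (iterPartial f w) (partialDomain f w) p

/-- The iterated partial derivative of `f` in the directions `w` exists at points arbitrarily close
to `p`, and it tends to `+∞` at `p` along the set where it exists. -/
def PartialTendstoTop (f : ℝ × ℝ → ℝ) (w : List (Fin 2)) (p : ℝ × ℝ) : Prop :=
  p ∈ closure (partialDomain f w) ∧
    Tendsto (iterPartial f w) (𝓝[partialDomain f w] p) atTop

/-- A phase of `f`: a connected region of the parameter space that is maximal for the condition
that `f` is analytic at each of its points (such a set is automatically open). -/
def IsPhase (f : ℝ × ℝ → ℝ) (U : Set (ℝ × ℝ)) : Prop :=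
  Maximal (fun V => V ⊆ paramSpace ∧ IsConnected V ∧ AnalyticOnNhd ℝ f V) U

/-- `f` has a phase transition of order `j` at `p`: `p` is a boundary point of a phase, at least
one partial derivative of order `j` is discontinuous at `p`, and all partial derivatives of lower
order (including `f` itself) are continuous at `p`. -/
def IsPhaseTransition (f : ℝ × ℝ → ℝ) (j : ℕ) (p : ℝ × ℝ) : Prop :=
  (∃ U, IsPhase f U ∧ p ∈ frontier U) ∧
    (∃ w : List (Fin 2), w.length = j ∧ ¬ PartialContinuousAt f w p) ∧
    ∀ w : List (Fin 2), w.length < j → PartialContinuousAt f w p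

end

/-! ### Averages of a function along a segment -/

/-! By independence of the Gaussian increments, `E[x_n] = x₀ · (T^n 1)(log ρ)`, where `T = transfer
v` averages over one Gaussian step of variance `v = σ²τ = 2β/n²` and multiplies by `1 + e^h`. For
such small `v` the iterate is governed by the paths from `log ρ` that maximize `∑ (softplus (h_i) -
(h_{i+1} - h_i)²/(2v))`. Energy conservation makes an optimal path climb with speed proportional to
`√(α - softplus h)`, where `α` is its maximal height. Hence `λ = max_α (α - K(α, ω)/√β)` with `ω =
log (1 + ρ)` and `K = ∫_ω^α wt(y) √(α - y) dy` (`tendsto_growthRate`). The lower bound follows an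
Euler scheme of the optimal path (`exp_le_iterate_transfer`); the upper bound sums supersolutions
attached to the possible maximal heights (`iterate_transfer_le_exp`).

An interior maximizer solves `F = 2√β`, where `F = 2 ∂_α K` is the function of the statement in the
coordinate `y = log (1 + e^x)`. The derivative `G = ∂_α F` is strictly increasing in `ω`. So `F` is
strictly increasing in `α` for `ρ > ρ_c`, and `G ≥ 0` at `ρ_c`, with a zero by compactness
(`exists_fluxG_eq_zero`); analyticity keeps `F` strictly increasing even there. The maximizer is
therefore unique for `ρ ≥ ρ_c`: this gives continuity of `λ` and its first partials at `(ρ_c, β_c)`,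
and analyticity for `ρ > ρ_c` by the inverse function theorem.

By the envelope theorem (`IsValue.lineDeriv_eq`) the first partials of `λ` are those of the action
at any maximizer `α`, and they increase with `α`. Maximizers increase with both parameters
(`IsMaximizer.le`). At the critical point the residual `F - 2√β` has zero derivative in `α` but
negative derivative in each parameter, so `α` moves arbitrarily fast compared with the parameters
(`eventually_steep_growth`). Every second partial, wherever it exists nearby, is therefore large.
This also excludes analyticity at the critical point, which adheres to the connected region `ρ >
ρ_c` of analyticity and so bounds a phase. -/

lemma segment_mem {x w lo hi d e : ℝ} (hx : lo ≤ x) (hx' : x ≤ hi) (hw : lo ≤ w) (hw' : w ≤ hi)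
    (hd : 0 ≤ d) (he : 0 ≤ e) (hde : d + e = 1) : x * d + w * e ∈ Set.Icc lo hi := by
  have h := convex_Icc lo hi ⟨hx, hx'⟩ ⟨hw, hw'⟩ hd he hde
  simpa [mul_comm] using h

lemma continuousOn_segment {g d e m : ℝ → ℝ} {x w : ℝ} (hg : ContinuousOn g (Set.Ioi 0))
    (hd : Continuous d) (he : Continuous e) (hm : Continuous m)
    (hd0 : ∀ t ∈ Set.Icc (0 : ℝ) 1, 0 ≤ d t) (he0 : ∀ t ∈ Set.Icc (0 : ℝ) 1, 0 ≤ e t)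
    (hde : ∀ t, d t + e t = 1) (hx : 0 < x) (hw : 0 < w) :
    ContinuousOn (fun t => m t * g (x * d t + w * e t)) (Set.Icc 0 1) := by
  refine hm.continuousOn.mul (hg.comp (by fun_prop) ?_)
  intro t ht
  have := segment_mem (min_le_left x w) (le_max_left x w) (min_le_right x w) (le_max_right x w)
    (hd0 t ht) (he0 t ht) (hde t)
  exact lt_of_lt_of_le (lt_min hx hw) this.1

/-- The weights `d` and `e` are kept abstract so that one proof serves both endpoints of the
segment. For a moving endpoint in `(x/2, 2x)` the argument of `g` stays in a compact subset of `(0,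
∞)`, where `g'` is bounded; this matters because `wt` blows up at `0`. -/
lemma hasDerivAt_segment_integral {g g' d e m : ℝ → ℝ} {x w : ℝ}
    (hg : ∀ y, 0 < y → HasDerivAt g (g' y) y) (hg' : ContinuousOn g' (Set.Ioi 0))
    (hd : Continuous d) (he : Continuous e) (hm : Continuous m)
    (hd0 : ∀ t ∈ Set.Icc (0 : ℝ) 1, 0 ≤ d t) (he0 : ∀ t ∈ Set.Icc (0 : ℝ) 1, 0 ≤ e t)
    (hde : ∀ t, d t + e t = 1) (hx : 0 < x) (hw : 0 < w) :
    HasDerivAt (fun x => ∫ t in (0 : ℝ)..1, m t * g (x * d t + w * e t))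
      (∫ t in (0 : ℝ)..1, (m t * d t) * g' (x * d t + w * e t)) x := by
  have hgc : ContinuousOn g (Set.Ioi 0) := fun y hy => (hg y hy).continuousAt.continuousWithinAt
  set lo := min (x / 2) w
  set hi := max (2 * x) w
  have hlo : 0 < lo := lt_min (by linarith) hw
  have hmemI : ∀ t ∈ Set.uIoc (0 : ℝ) 1, t ∈ Set.Icc (0 : ℝ) 1 := by
    intro t ht; rw [Set.uIoc_of_le zero_le_one] at ht; exact ⟨ht.1.le, ht.2⟩
  have hmem : ∀ t ∈ Set.uIoc (0 : ℝ) 1, ∀ z ∈ Set.Ioo (x / 2) (2 * x),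
      z * d t + w * e t ∈ Set.Icc lo hi := by
    intro t ht z hz
    exact segment_mem ((min_le_left _ _).trans hz.1.le) (hz.2.le.trans (le_max_left _ _))
      (min_le_right _ _) (le_max_right _ _) (hd0 t (hmemI t ht)) (he0 t (hmemI t ht)) (hde t)
  obtain ⟨C, hC⟩ := isCompact_Icc.exists_bound_of_continuousOn
    (hg'.mono (fun y (hy : y ∈ Set.Icc lo hi) => lt_of_lt_of_le hlo hy.1))
  obtain ⟨D, hD⟩ := isCompact_Icc.exists_bound_of_continuousOn
    ((hm.mul hd).continuousOn (s := Set.Icc (0 : ℝ) 1))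
  have hD0 : 0 ≤ D := (norm_nonneg _).trans (hD 0 (by simp))
  have hnhds : Set.Ioo (x / 2) (2 * x) ∈ 𝓝 x := Ioo_mem_nhds (by linarith) (by linarith)
  have hmeas : ∀ {φ m : ℝ → ℝ}, ContinuousOn φ (Set.Ioi 0) → Continuous m → ∀ z, 0 < z →
      AEStronglyMeasurable (fun t => m t * φ (z * d t + w * e t))
        (volume.restrict (Set.uIoc 0 1)) := by
    intro φ m hφ hm z hz
    have := continuousOn_segment hφ hd he hm hd0 he0 hde hz hw
    exact (this.mono hmemI).aestronglyMeasurable measurableSet_uIoc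
  refine (intervalIntegral.hasDerivAt_integral_of_dominated_loc_of_deriv_le
    (F' := fun z t => (m t * d t) * g' (z * d t + w * e t))
    (bound := fun _ => D * C) hnhds ?_ ?_ ?_ ?_ ?_ ?_).2
  · filter_upwards [hnhds] with z hz
    exact hmeas hgc hm z (by linarith [hz.1])
  · apply ContinuousOn.intervalIntegrable
    rw [Set.uIcc_of_le zero_le_one]
    exact continuousOn_segment hgc hd he hm hd0 he0 hde hx hw
  · exact hmeas hg' (hm.mul hd) x hx
  · refine Eventually.of_forall fun t ht z hz => ?_
    rw [norm_mul]
    exact mul_le_mul (hD t (hmemI t ht)) (hC _ (hmem t ht z hz)) (norm_nonneg _) hD0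
  · exact intervalIntegrable_const
  · refine Eventually.of_forall fun t ht z hz => ?_
    have h1 := hg _ (lt_of_lt_of_le hlo (hmem t ht z hz).1)
    have h2 : HasDerivAt (fun z => z * d t + w * e t) (d t) z := by
      simpa using ((hasDerivAt_id z).mul_const (d t)).add_const (w * e t)
    convert! (h1.comp z h2).const_mul (m t) using 1
    ring

/-- The average of `m t * g` over the parabolic parametrization of the segment from `α` to `ω`. -/
noncomputable def parAvg (m g : ℝ → ℝ) (α ω : ℝ) : ℝ :=
  ∫ t in (0 : ℝ)..1, m t * g (α * (1 - t ^ 2) + ω * t ^ 2)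

lemma one_sub_sq_nonneg {t : ℝ} (ht : t ∈ Set.Icc (0 : ℝ) 1) : 0 ≤ 1 - t ^ 2 := by
  nlinarith [ht.1, ht.2]

lemma parAvg_mem {α ω lo hi t : ℝ} (hx : lo ≤ α) (hx' : α ≤ hi) (hw : lo ≤ ω) (hw' : ω ≤ hi)
    (ht : t ∈ Set.Icc (0 : ℝ) 1) : α * (1 - t ^ 2) + ω * t ^ 2 ∈ Set.Icc lo hi :=
  segment_mem hx hx' hw hw' (one_sub_sq_nonneg ht) (sq_nonneg t) (by ring)

lemma continuousOn_parAvg {m g : ℝ → ℝ} {α ω : ℝ} (hg : ContinuousOn g (Set.Ioi 0))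
    (hm : Continuous m) (hα : 0 < α) (hω : 0 < ω) :
    ContinuousOn (fun t => m t * g (α * (1 - t ^ 2) + ω * t ^ 2)) (Set.Icc 0 1) :=
  continuousOn_segment (d := fun t => 1 - t ^ 2) (e := fun t => t ^ 2) hg (by fun_prop)
    (by fun_prop) hm (fun _ ht => one_sub_sq_nonneg ht) (fun t _ => sq_nonneg t)
    (fun t => by ring) hα hω

lemma intervalIntegrable_parAvg {m g : ℝ → ℝ} {α ω : ℝ} (hg : ContinuousOn g (Set.Ioi 0))
    (hm : Continuous m) (hα : 0 < α) (hω : 0 < ω) :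
    IntervalIntegrable (fun t => m t * g (α * (1 - t ^ 2) + ω * t ^ 2)) volume 0 1 := by
  apply ContinuousOn.intervalIntegrable
  rw [Set.uIcc_of_le zero_le_one]
  exact continuousOn_parAvg hg hm hα hω

lemma hasDerivAt_parAvg_left {m g g' : ℝ → ℝ} {α ω : ℝ}
    (hg : ∀ y, 0 < y → HasDerivAt g (g' y) y) (hg' : ContinuousOn g' (Set.Ioi 0))
    (hm : Continuous m) (hα : 0 < α) (hω : 0 < ω) :
    HasDerivAt (fun α => parAvg m g α ω) (parAvg (fun t => m t * (1 - t ^ 2)) g' α ω) α :=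
  hasDerivAt_segment_integral (d := fun t => 1 - t ^ 2) (e := fun t => t ^ 2) hg hg'
    (by fun_prop) (by fun_prop) hm (fun _ ht => one_sub_sq_nonneg ht) (fun t _ => sq_nonneg t)
    (fun t => by ring) hα hω

lemma hasDerivAt_parAvg_right {m g g' : ℝ → ℝ} {α ω : ℝ}
    (hg : ∀ y, 0 < y → HasDerivAt g (g' y) y) (hg' : ContinuousOn g' (Set.Ioi 0))
    (hm : Continuous m) (hα : 0 < α) (hω : 0 < ω) :
    HasDerivAt (fun ω => parAvg m g α ω) (parAvg (fun t => m t * t ^ 2) g' α ω) ω := by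
  have h := hasDerivAt_segment_integral (m := m) (d := fun t => t ^ 2) (e := fun t => 1 - t ^ 2)
    hg hg' (by fun_prop) (by fun_prop) hm (fun t _ => sq_nonneg t)
    (fun _ ht => one_sub_sq_nonneg ht) (fun t => by ring) hω hα
  simpa only [parAvg, add_comm] using h

lemma parAvg_add {m₁ m₂ g : ℝ → ℝ} {α ω : ℝ} (hg : ContinuousOn g (Set.Ioi 0))
    (h₁ : Continuous m₁) (h₂ : Continuous m₂) (hα : 0 < α) (hω : 0 < ω) :
    parAvg (fun t => m₁ t + m₂ t) g α ω = parAvg m₁ g α ω + parAvg m₂ g α ω := by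
  unfold parAvg
  rw [← intervalIntegral.integral_add (intervalIntegrable_parAvg hg h₁ hα hω)
    (intervalIntegrable_parAvg hg h₂ hα hω)]
  simp only [add_mul]

lemma parAvg_const_mul (c : ℝ) (m g : ℝ → ℝ) (α ω : ℝ) :
    parAvg (fun t => c * m t) g α ω = c * parAvg m g α ω := by
  unfold parAvg
  rw [← intervalIntegral.integral_const_mul]
  simp only [mul_assoc]

/-- Integration by parts along the parabolic parametrization. -/
lemma parAvg_by_parts {m m' g g' : ℝ → ℝ} {α ω : ℝ}
    (hg : ∀ y, 0 < y → HasDerivAt g (g' y) y) (hg' : ContinuousOn g' (Set.Ioi 0))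
    (hm : ∀ t, HasDerivAt m (m' t) t) (hm' : Continuous m') (hα : 0 < α) (hω : 0 < ω) :
    parAvg m' g α ω - 2 * (α - ω) * parAvg (fun t => t * m t) g' α ω = m 1 * g ω - m 0 * g α := by
  have hgc : ContinuousOn g (Set.Ioi 0) := fun y hy => (hg y hy).continuousAt.continuousWithinAt
  have hmc : Continuous m := continuous_iff_continuousAt.2 fun t => (hm t).continuousAt
  have key := intervalIntegral.integral_eq_sub_of_hasDerivAt (a := 0) (b := 1)
    (f := fun t => m t * g (α * (1 - t ^ 2) + ω * t ^ 2))
    (f' := fun t => m' t * g (α * (1 - t ^ 2) + ω * t ^ 2) -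
      (2 * (α - ω)) * ((t * m t) * g' (α * (1 - t ^ 2) + ω * t ^ 2))) ?_ ?_
  · rw [intervalIntegral.integral_sub (intervalIntegrable_parAvg hgc hm' hα hω)
      ((intervalIntegrable_parAvg hg' (by fun_prop) hα hω).const_mul _),
      intervalIntegral.integral_const_mul] at key
    unfold parAvg
    rw [key]
    simp
  · intro t ht
    rw [Set.uIcc_of_le zero_le_one] at ht
    have hpos : 0 < α * (1 - t ^ 2) + ω * t ^ 2 := lt_of_lt_of_le (lt_min hα hω)
      (parAvg_mem (min_le_left α ω) (le_max_left α ω) (min_le_right _ _) (le_max_right _ _) ht).1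
    have h2 : HasDerivAt (fun t : ℝ => α * (1 - t ^ 2) + ω * t ^ 2) (-(2 * (α - ω)) * t) t := by
      have := ((((hasDerivAt_id t).pow 2).const_sub 1).const_mul α).add
        (((hasDerivAt_id t).pow 2).const_mul ω)
      convert! this using 1
      simp
      ring
    convert! (hm t).mul ((hg _ hpos).comp t h2) using 1
    simp
    ring
  · exact (intervalIntegrable_parAvg hgc hm' hα hω).sub
      ((intervalIntegrable_parAvg hg' (by fun_prop) hα hω).const_mul _)

/-- The Abel transform `∫_ω^α g(y) / √(α - y) dy`. -/
noncomputable def abelTransform (g : ℝ → ℝ) (α ω : ℝ) : ℝ :=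
  2 * √(α - ω) * parAvg (fun _ => 1) g α ω

lemma hasDerivAt_sqrt_sub_left {α ω : ℝ} (h : ω < α) :
    HasDerivAt (fun α => √(α - ω)) (1 / (2 * √(α - ω))) α :=
  ((hasDerivAt_id α).sub_const ω).sqrt (sub_pos.2 h).ne'

lemma hasDerivAt_sqrt_sub_right {α ω : ℝ} (h : ω < α) :
    HasDerivAt (fun ω => √(α - ω)) (-1 / (2 * √(α - ω))) ω :=
  ((hasDerivAt_id ω).const_sub α).sqrt (sub_pos.2 h).ne'

/-- The substitution `y = α(1 - t²) + ωt²` turns `dy / √(α - y)` into `2√(α - ω) dt` and so removes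
the singularity at `y = α`. After differentiation, integration by parts with `m = t` collapses
everything to the integrand at the lower endpoint. -/
lemma hasDerivAt_abelTransform_right {g g' : ℝ → ℝ} {α ω : ℝ}
    (hg : ∀ y, 0 < y → HasDerivAt g (g' y) y) (hg' : ContinuousOn g' (Set.Ioi 0))
    (hω : 0 < ω) (h : ω < α) :
    HasDerivAt (fun ω => abelTransform g α ω) (-g ω / √(α - ω)) ω := by
  have hs : 0 < √(α - ω) := Real.sqrt_pos.2 (sub_pos.2 h)
  have hsq : √(α - ω) ^ 2 = α - ω := Real.sq_sqrt (sub_pos.2 h).le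
  have h1 := parAvg_by_parts (m := fun t => t) (m' := fun _ => 1) hg hg' (fun t => hasDerivAt_id t)
    (by fun_prop) (hω.trans h) hω
  have h2 : (fun t : ℝ => t * t) = (fun t => 1 * t ^ 2) := by ext; ring
  rw [h2] at h1
  convert! ((hasDerivAt_sqrt_sub_right h).const_mul 2).mul
    (hasDerivAt_parAvg_right (m := fun _ => 1) hg hg' (by fun_prop) (hω.trans h) hω) using 1
  generalize parAvg (fun t => 1 * t ^ 2) g' α ω = A at *
  field_simp
  rw [hsq]
  linarith

/-- With `s = α - y` the transform reads `∫_0^{α-ω} g(α - s)/√s ds`: moving `α` gives one boundary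
term and the transform of `g'`. -/
lemma hasDerivAt_abelTransform_left {g g' : ℝ → ℝ} {α ω : ℝ}
    (hg : ∀ y, 0 < y → HasDerivAt g (g' y) y) (hg' : ContinuousOn g' (Set.Ioi 0))
    (hω : 0 < ω) (h : ω < α) :
    HasDerivAt (fun α => abelTransform g α ω) (g ω / √(α - ω) + abelTransform g' α ω) α := by
  have hs : 0 < √(α - ω) := Real.sqrt_pos.2 (sub_pos.2 h)
  have hsq : √(α - ω) ^ 2 = α - ω := Real.sq_sqrt (sub_pos.2 h).le
  have h1 := parAvg_by_parts (m := fun t => t) (m' := fun _ => 1) hg hg' (fun t => hasDerivAt_id t)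
    (by fun_prop) (hω.trans h) hω
  have h2 : parAvg (fun t => 1 * (1 - t ^ 2)) g' α ω =
      parAvg (fun _ => 1) g' α ω - parAvg (fun t => t * t) g' α ω := by
    rw [eq_sub_iff_add_eq, ← parAvg_add hg' (by fun_prop) (by fun_prop) (hω.trans h) hω]
    congr 1; ext; ring
  convert! ((hasDerivAt_sqrt_sub_left h).const_mul 2).mul
    (hasDerivAt_parAvg_left (m := fun _ => 1) hg hg' (by fun_prop) (hω.trans h) hω) using 1
  rw [h2, abelTransform]
  generalize parAvg (fun t => t * t) g' α ω = A at *
  field_simp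
  rw [hsq]
  linarith

/-- The half-order companion `∫_ω^α g(y) √(α - y) dy` of the Abel transform. -/
noncomputable def abelHalf (g : ℝ → ℝ) (α ω : ℝ) : ℝ :=
  2 * ((α - ω) * √(α - ω)) * parAvg (fun t => t ^ 2) g α ω

lemma hasDerivAt_abelHalf_right {g g' : ℝ → ℝ} {α ω : ℝ}
    (hg : ∀ y, 0 < y → HasDerivAt g (g' y) y) (hg' : ContinuousOn g' (Set.Ioi 0))
    (hω : 0 < ω) (h : ω < α) :
    HasDerivAt (fun ω => abelHalf g α ω) (-(g ω * √(α - ω))) ω := by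
  have hsq : √(α - ω) ^ 2 = α - ω := Real.sq_sqrt (sub_pos.2 h).le
  have h1 := parAvg_by_parts (m := fun t => t ^ 3) (m' := fun t => 3 * t ^ 2) hg hg'
    (fun t => by simpa using hasDerivAt_pow 3 t) (by fun_prop) (hω.trans h) hω
  have h2 : (fun t : ℝ => t * t ^ 3) = (fun t => t ^ 2 * t ^ 2) := by ext; ring
  rw [h2, parAvg_const_mul] at h1
  convert! ((((hasDerivAt_id ω).const_sub α).mul (hasDerivAt_sqrt_sub_right h)).const_mul 2).mul
    (hasDerivAt_parAvg_right (m := fun t => t ^ 2) hg hg' (by fun_prop) (hω.trans h) hω) using 1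
  simp only [id, Pi.mul_apply]
  have : g ω = 3 * parAvg (fun t => t ^ 2) g α ω -
    2 * (α - ω) * parAvg (fun t => t ^ 2 * t ^ 2) g' α ω := by linarith
  generalize √(α - ω) = s at *
  rw [this, ← hsq]
  field_simp
  ring

/-- The kernel `√(α - y)` vanishes at `y = α`, so there is no boundary term, and its `α`-derivative
is half the Abel kernel. -/
lemma hasDerivAt_abelHalf_left {g g' : ℝ → ℝ} {α ω : ℝ}
    (hg : ∀ y, 0 < y → HasDerivAt g (g' y) y) (hg' : ContinuousOn g' (Set.Ioi 0))
    (hω : 0 < ω) (h : ω < α) :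
    HasDerivAt (fun α => abelHalf g α ω) (abelTransform g α ω / 2) α := by
  have hsq : √(α - ω) ^ 2 = α - ω := Real.sq_sqrt (sub_pos.2 h).le
  have hgc : ContinuousOn g (Set.Ioi 0) := fun y hy => (hg y hy).continuousAt.continuousWithinAt
  have h1 := parAvg_by_parts (m := fun t => t - t ^ 3) (m' := fun t => 1 + (-3) * t ^ 2) hg hg'
    (fun t => by
      convert! (hasDerivAt_id t).sub (hasDerivAt_pow 3 t) using 1
      norm_num
      ring) (by fun_prop) (hω.trans h) hω
  have h2 : (fun t : ℝ => t * (t - t ^ 3)) = (fun t => t ^ 2 * (1 - t ^ 2)) := by ext; ring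
  rw [h2, parAvg_add hgc (by fun_prop) (by fun_prop) (hω.trans h) hω, parAvg_const_mul] at h1
  convert! ((((hasDerivAt_id α).sub_const ω).mul (hasDerivAt_sqrt_sub_left h)).const_mul 2).mul
    (hasDerivAt_parAvg_left (m := fun t => t ^ 2) hg hg' (by fun_prop) (hω.trans h) hω) using 1
  simp only [id, abelTransform, Pi.mul_apply]
  have : parAvg (fun _ => 1) g α ω = 3 * parAvg (fun t => t ^ 2) g α ω +
    2 * (α - ω) * parAvg (fun t => t ^ 2 * (1 - t ^ 2)) g' α ω := by norm_num at h1; linarith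
  generalize √(α - ω) = s at *
  rw [this, ← hsq]
  field_simp
  ring

/-! ### The weight `r` -/

/-- The derivative `dx / dy` for `y = log (1 + exp x)`, as a function of `y`. -/
noncomputable def wt (y : ℝ) : ℝ := (1 - Real.exp (-y))⁻¹

/-- The derivative of `wt`. -/
noncomputable def wt₁ (y : ℝ) : ℝ := -(Real.exp (-y) * wt y ^ 2)

/-- The second derivative of `wt`. -/
noncomputable def wt₂ (y : ℝ) : ℝ := Real.exp (-y) * wt y ^ 2 - Real.exp (-y) * (2 * wt y * wt₁ y)

lemma one_sub_exp_neg_pos {y : ℝ} (hy : 0 < y) : 0 < 1 - Real.exp (-y) := by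
  have : Real.exp (-y) < 1 := Real.exp_lt_one_iff.2 (by linarith)
  linarith

lemma hasDerivAt_wt {y : ℝ} (hy : 0 < y) : HasDerivAt wt (wt₁ y) y := by
  have h := one_sub_exp_neg_pos hy
  have h1 : HasDerivAt (fun y => 1 - Real.exp (-y)) (Real.exp (-y)) y := by
    simpa using ((hasDerivAt_neg y).exp).const_sub 1
  convert! h1.inv h.ne' using 1
  simp [wt₁, wt]
  field_simp

lemma hasDerivAt_wt₁ {y : ℝ} (hy : 0 < y) : HasDerivAt wt₁ (wt₂ y) y := by
  have h1 : HasDerivAt (fun y => Real.exp (-y)) (-Real.exp (-y)) y := by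
    simpa using (hasDerivAt_neg y).exp
  convert! (h1.mul ((hasDerivAt_wt hy).pow 2)).neg using 1
  simp [wt₂]
  ring

lemma continuousOn_wt : ContinuousOn wt (Set.Ioi 0) :=
  fun _ hy => (hasDerivAt_wt hy).continuousAt.continuousWithinAt

lemma continuousOn_wt₁ : ContinuousOn wt₁ (Set.Ioi 0) :=
  fun _ hy => (hasDerivAt_wt₁ hy).continuousAt.continuousWithinAt

lemma continuousOn_wt₂ : ContinuousOn wt₂ (Set.Ioi 0) := by
  have := continuousOn_wt
  have := continuousOn_wt₁
  unfold wt₂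
  fun_prop

lemma one_lt_wt {y : ℝ} (hy : 0 < y) : 1 < wt y := by
  have h := one_sub_exp_neg_pos hy
  have := Real.exp_pos (-y)
  exact (one_lt_inv₀ h).2 (by linarith)

lemma wt_pos {y : ℝ} (hy : 0 < y) : 0 < wt y := zero_lt_one.trans (one_lt_wt hy)

lemma inv_le_wt {y : ℝ} (hy : 0 < y) : y⁻¹ ≤ wt y := by
  have h := one_sub_exp_neg_pos hy
  have := Real.add_one_le_exp (-y)
  exact inv_anti₀ h (by linarith)

lemma wt_anti {x y : ℝ} (hx : 0 < x) (hxy : x ≤ y) : wt y ≤ wt x := by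
  have h := one_sub_exp_neg_pos hx
  have := Real.exp_le_exp.2 (neg_le_neg hxy)
  exact inv_anti₀ h (by linarith)

lemma neg_wt₁_le {ω y : ℝ} (hω : 0 < ω) (h : ω ≤ y) :
    -wt₁ y ≤ Real.exp (-y) * wt ω ^ 2 := by
  have h1 := wt_anti hω h
  have h2 := wt_pos (hω.trans_le h)
  simp only [wt₁, neg_neg]
  gcongr

/-- The function `F` of the coordinates `α = log (1 + exp a)` and `ω = log (1 + ρ)`. -/
noncomputable def fluxF (α ω : ℝ) : ℝ := abelTransform wt α ω

/-- The derivative of `fluxF` in `α`. -/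
noncomputable def fluxG (α ω : ℝ) : ℝ := wt ω / √(α - ω) + abelTransform wt₁ α ω

/-- The action `∫_ω^α wt(y) √(α - y) dy`. -/
noncomputable def fluxK (α ω : ℝ) : ℝ := abelHalf wt α ω

lemma hasDerivAt_fluxF_left {α ω : ℝ} (hω : 0 < ω) (h : ω < α) :
    HasDerivAt (fun α => fluxF α ω) (fluxG α ω) α :=
  hasDerivAt_abelTransform_left (fun _ => hasDerivAt_wt) continuousOn_wt₁ hω h

lemma hasDerivAt_fluxF_right {α ω : ℝ} (hω : 0 < ω) (h : ω < α) :
    HasDerivAt (fun ω => fluxF α ω) (-wt ω / √(α - ω)) ω :=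
  hasDerivAt_abelTransform_right (fun _ => hasDerivAt_wt) continuousOn_wt₁ hω h

lemma hasDerivAt_fluxK_left {α ω : ℝ} (hω : 0 < ω) (h : ω < α) :
    HasDerivAt (fun α => fluxK α ω) (fluxF α ω / 2) α :=
  hasDerivAt_abelHalf_left (fun _ => hasDerivAt_wt) continuousOn_wt₁ hω h

lemma hasDerivAt_fluxK_right {α ω : ℝ} (hω : 0 < ω) (h : ω < α) :
    HasDerivAt (fun ω => fluxK α ω) (-(wt ω * √(α - ω))) ω :=
  hasDerivAt_abelHalf_right (fun _ => hasDerivAt_wt) continuousOn_wt₁ hω h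

/-- The two contributions of `wt₁ ω` cancel, and what remains is positive. This sign is why the set
of `ρ` with a decreasing `F` controls all smaller and larger `ρ`. -/
lemma hasDerivAt_fluxG_right {α ω : ℝ} (hω : 0 < ω) (h : ω < α) :
    HasDerivAt (fun ω => fluxG α ω) (wt ω / (2 * ((α - ω) * √(α - ω)))) ω := by
  have hs : 0 < √(α - ω) := Real.sqrt_pos.2 (sub_pos.2 h)
  have hsq : √(α - ω) ^ 2 = α - ω := Real.sq_sqrt (sub_pos.2 h).le
  convert! ((hasDerivAt_wt hω).div (hasDerivAt_sqrt_sub_right h) hs.ne').add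
    (hasDerivAt_abelTransform_right (fun _ => hasDerivAt_wt₁) continuousOn_wt₂ hω h) using 1
  rw [hsq]
  generalize √(α - ω) = s at *
  rw [← hsq]
  field_simp
  ring

/-! ### Joint analyticity -/

/-- The integrand is viewed as an element of the Banach algebra `C([0,1], ℝ)` depending on `p`. It
is obtained from a continuous linear map by the exponential and by inversion, both analytic;
multiplication by `m` and integration are bounded linear. -/
lemma analyticAt_parAvg_wt {m : C(ℝ, ℝ)} {p : ℝ × ℝ} (h₁ : 0 < p.1) (h₂ : 0 < p.2) :
    AnalyticAt ℝ (fun p : ℝ × ℝ => parAvg m wt p.1 p.2) p := by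
  let c₁ : C(unitInterval, ℝ) := ⟨fun t => 1 - (t : ℝ) ^ 2, by fun_prop⟩
  let c₂ : C(unitInterval, ℝ) := ⟨fun t => (t : ℝ) ^ 2, by fun_prop⟩
  let m' : C(unitInterval, ℝ) := ⟨fun t => m t, by fun_prop⟩
  let ℓ : ℝ × ℝ →L[ℝ] C(unitInterval, ℝ) :=
    (ContinuousLinearMap.fst ℝ ℝ ℝ).smulRight c₁ + (ContinuousLinearMap.snd ℝ ℝ ℝ).smulRight c₂
  let v : ℝ × ℝ → C(unitInterval, ℝ) := fun p => 1 - NormedSpace.exp (-(ℓ p))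
  have hint : ∀ x : C(unitInterval, ℝ), IntervalIntegrable
      (fun t => x (Set.projIcc 0 1 zero_le_one t)) volume 0 1 := fun x =>
    (x.continuous.comp continuous_projIcc).intervalIntegrable 0 1
  let I : C(unitInterval, ℝ) →L[ℝ] ℝ := LinearMap.mkContinuous
    { toFun := fun x => ∫ t in (0 : ℝ)..1, x (Set.projIcc 0 1 zero_le_one t)
      map_add' := fun x y => by
        rw [← intervalIntegral.integral_add (hint x) (hint y)]; rfl
      map_smul' := fun c x => by
        simp [intervalIntegral.integral_const_mul] } 1 (fun x => by
      have := intervalIntegral.norm_integral_le_of_norm_le_const (a := 0) (b := 1)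
        (f := fun t => x (Set.projIcc 0 1 zero_le_one t)) (C := ‖x‖)
        (fun t _ => x.norm_coe_le_norm _)
      simpa using this)
  have hv : ∀ p t, v p t = 1 - Real.exp (-(p.1 * (1 - (t : ℝ) ^ 2) + p.2 * (t : ℝ) ^ 2)) := by
    intro p t
    -- Evaluation at `t` is a continuous ring homomorphism, so it commutes with the exponential.
    have h := NormedSpace.map_exp
      ((Pi.evalRingHom (fun _ : unitInterval => ℝ) t).comp ContinuousMap.coeFnRingHom)
      (continuous_eval_const t) (-(ℓ p))
    rw [← Real.exp_eq_exp_ℝ] at h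
    change 1 - (NormedSpace.exp (-(ℓ p))) t = _
    exact congrArg (fun z => 1 - z) h
  have hvan : AnalyticAt ℝ v p := by
    refine analyticAt_const.sub ?_
    exact (NormedSpace.exp_analytic (𝕂 := ℝ) _).comp (ℓ.analyticAt p).neg
  have hunit : ∀ p : ℝ × ℝ, 0 < p.1 → 0 < p.2 → IsUnit (v p) := by
    intro p h₁ h₂
    rw [ContinuousMap.isUnit_iff_forall_ne_zero]
    intro t
    rw [hv]
    exact (one_sub_exp_neg_pos (lt_of_lt_of_le (lt_min h₁ h₂)
      (parAvg_mem (min_le_left _ _) (le_max_left _ _) (min_le_right _ _) (le_max_right _ _)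
        t.2).1)).ne'
  have hinv : AnalyticAt ℝ (fun p => I (m' * Ring.inverse (v p))) p := by
    refine (I.analyticAt _).comp (analyticAt_const.mul ?_)
    obtain ⟨u, hu⟩ := hunit p h₁ h₂
    have := analyticAt_inverse (𝕜 := ℝ) u
    rw [hu] at this
    exact this.comp hvan
  refine hinv.congr ?_
  have hnhds : ∀ᶠ q : ℝ × ℝ in 𝓝 p, 0 < q.1 ∧ 0 < q.2 :=
    (continuous_fst.continuousAt.eventually (lt_mem_nhds h₁)).and
      (continuous_snd.continuousAt.eventually (lt_mem_nhds h₂))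
  filter_upwards [hnhds] with q hq
  change (∫ t in (0 : ℝ)..1, (m' * Ring.inverse (v q)) (Set.projIcc 0 1 zero_le_one t)) = _
  unfold parAvg
  refine intervalIntegral.integral_congr fun t ht => ?_
  rw [Set.uIcc_of_le zero_le_one] at ht
  have hone := congrArg (fun x : C(unitInterval, ℝ) => x ⟨t, ht⟩)
    (Ring.mul_inverse_cancel _ (hunit q hq.1 hq.2))
  simp only [ContinuousMap.mul_apply, ContinuousMap.one_apply, hv] at hone
  simp only [Set.projIcc_of_mem zero_le_one ht, ContinuousMap.mul_apply, wt]
  rw [eq_inv_of_mul_eq_one_right hone]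
  rfl

lemma analyticAt_sqrt_sub {p : ℝ × ℝ} (h : p.2 < p.1) :
    AnalyticAt ℝ (fun p : ℝ × ℝ => √(p.1 - p.2)) p :=
  (Real.contDiffAt_sqrt (n := ⊤) (sub_pos.2 h).ne').analyticAt.comp
    (f := fun p : ℝ × ℝ => p.1 - p.2) (analyticAt_fst.sub analyticAt_snd)

lemma analyticAt_fluxF {p : ℝ × ℝ} (h₂ : 0 < p.2) (h : p.2 < p.1) :
    AnalyticAt ℝ (fun p : ℝ × ℝ => fluxF p.1 p.2) p :=
  (analyticAt_const.mul (analyticAt_sqrt_sub h)).mul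
    (analyticAt_parAvg_wt (m := ⟨fun _ => 1, by fun_prop⟩) (h₂.trans h) h₂)

lemma analyticAt_fluxK {p : ℝ × ℝ} (h₂ : 0 < p.2) (h : p.2 < p.1) :
    AnalyticAt ℝ (fun p : ℝ × ℝ => fluxK p.1 p.2) p :=
  (analyticAt_const.mul ((analyticAt_fst.sub analyticAt_snd).mul (analyticAt_sqrt_sub h))).mul
    (analyticAt_parAvg_wt (m := ⟨fun t => t ^ 2, by fun_prop⟩) (h₂.trans h) h₂)

/-! ### Change of coordinates -/

/-- The softplus function `x ↦ log (1 + exp x)`. -/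
noncomputable def softplus (x : ℝ) : ℝ := Real.log (1 + Real.exp x)

lemma softplus_pos (x : ℝ) : 0 < softplus x :=
  Real.log_pos (by linarith [Real.exp_pos x])

lemma hasDerivAt_softplus (x : ℝ) :
    HasDerivAt softplus (Real.exp x / (1 + Real.exp x)) x :=
  ((Real.hasDerivAt_exp x).const_add 1).log (by positivity)

lemma continuous_softplus : Continuous softplus :=
  continuous_iff_continuousAt.2 fun x => (hasDerivAt_softplus x).continuousAt

lemma strictMono_softplus : StrictMono softplus := fun x y h =>
  Real.log_lt_log (by positivity) (by linarith [Real.exp_lt_exp.2 h])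

lemma exp_softplus (x : ℝ) : Real.exp (softplus x) = 1 + Real.exp x :=
  Real.exp_log (by positivity)

lemma softplus_log {ρ : ℝ} (hρ : 0 < ρ) : softplus (Real.log ρ) = Real.log (1 + ρ) := by
  rw [softplus, Real.exp_log hρ]

lemma exists_softplus_eq {y : ℝ} (hy : 0 < y) : ∃ x, softplus x = y :=
  ⟨Real.log (Real.exp y - 1), by
    rw [softplus_log (by linarith [Real.add_one_lt_exp hy.ne'])]
    simp⟩

lemma wt_softplus (x : ℝ) : wt (softplus x) * (Real.exp x / (1 + Real.exp x)) = 1 := by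
  rw [wt, Real.exp_neg, exp_softplus]
  have := Real.exp_pos x
  have h : 1 - (1 + Real.exp x)⁻¹ ≠ 0 := by
    rw [← one_div, one_sub_div (by positivity)]
    simp
    positivity
  field_simp
  ring

lemma fluxF_self (α : ℝ) : fluxF α α = 0 := by simp [fluxF, abelTransform]

lemma fluxK_self (α : ℝ) : fluxK α α = 0 := by simp [fluxK, abelHalf]

lemma continuousAt_parAvg_wt_right {m : ℝ → ℝ} (hm : Continuous m) {α ω : ℝ} (hα : 0 < α)
    (hω : 0 < ω) : ContinuousAt (fun ω => parAvg m wt α ω) ω :=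
  (hasDerivAt_parAvg_right (fun _ => hasDerivAt_wt) continuousOn_wt₁ hm hα hω).continuousAt

lemma continuousAt_parAvg_wt_left {m : ℝ → ℝ} (hm : Continuous m) {α ω : ℝ} (hα : 0 < α)
    (hω : 0 < ω) : ContinuousAt (fun α => parAvg m wt α ω) α :=
  (hasDerivAt_parAvg_left (fun _ => hasDerivAt_wt) continuousOn_wt₁ hm hα hω).continuousAt

lemma continuousAt_fluxF_right {α ω : ℝ} (hα : 0 < α) (hω : 0 < ω) :
    ContinuousAt (fun ω => fluxF α ω) ω :=
  ContinuousAt.mul (by fun_prop) (continuousAt_parAvg_wt_right continuous_const hα hω)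

lemma continuousAt_fluxK_right {α ω : ℝ} (hα : 0 < α) (hω : 0 < ω) :
    ContinuousAt (fun ω => fluxK α ω) ω :=
  ContinuousAt.mul (by fun_prop) (continuousAt_parAvg_wt_right (by fun_prop) hα hω)

lemma continuousAt_fluxK_left {α ω : ℝ} (hα : 0 < α) (hω : 0 < ω) :
    ContinuousAt (fun α => fluxK α ω) α :=
  ContinuousAt.mul (by fun_prop) (continuousAt_parAvg_wt_left (by fun_prop) hα hω)

/-- The integrand is unbounded near `x = a`, so the fundamental theorem is used with a primitive
that is continuous on the closed interval and differentiable only inside; integrability comes for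
free from the sign of the derivative. -/
lemma integral_inv_sqrt_softplus {a u : ℝ} (h : u < a) :
    ∫ x in u..a, 1 / √(Real.log ((1 + Real.exp a) / (1 + Real.exp x))) =
      fluxF (softplus a) (softplus u) := by
  have hcont : ContinuousOn (fun x => -fluxF (softplus a) (softplus x)) (Set.Icc u a) :=
    fun x _ => ((continuousAt_fluxF_right (softplus_pos a) (softplus_pos x)).comp
      continuous_softplus.continuousAt).neg.continuousWithinAt
  have hderiv : ∀ x ∈ Set.Ioo u a, HasDerivAt (fun x => -fluxF (softplus a) (softplus x))
      (1 / √(Real.log ((1 + Real.exp a) / (1 + Real.exp x)))) x := by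
    intro x hx
    convert! ((hasDerivAt_fluxF_right (softplus_pos x) (strictMono_softplus hx.2)).comp x
      (hasDerivAt_softplus x)).neg using 1
    rw [Real.log_div (by positivity) (by positivity)]
    change 1 / √(softplus a - softplus x) = _
    linear_combination (-(1 / √(softplus a - softplus x))) * wt_softplus x
  rw [intervalIntegral.integral_eq_sub_of_hasDerivAt_of_le h.le hcont hderiv]
  · simp [fluxF_self]
  · apply intervalIntegral.intervalIntegrable_deriv_of_nonneg
    · rwa [Set.uIcc_of_le h.le]
    · rwa [min_eq_left h.le, max_eq_right h.le]
    · intro x _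
      positivity

lemma integral_sqrt_softplus {a u : ℝ} (h : u ≤ a) :
    ∫ x in u..a, √(softplus a - softplus x) = fluxK (softplus a) (softplus u) := by
  have hcont : ContinuousOn (fun x => -fluxK (softplus a) (softplus x)) (Set.Icc u a) :=
    fun x _ => ((continuousAt_fluxK_right (softplus_pos a) (softplus_pos x)).comp
      continuous_softplus.continuousAt).neg.continuousWithinAt
  have hderiv : ∀ x ∈ Set.Ioo u a, HasDerivAt (fun x => -fluxK (softplus a) (softplus x))
      (√(softplus a - softplus x)) x := by
    intro x hx
    convert! ((hasDerivAt_fluxK_right (softplus_pos x) (strictMono_softplus hx.2)).comp x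
      (hasDerivAt_softplus x)).neg using 1
    linear_combination (-(√(softplus a - softplus x))) * wt_softplus x
  rw [intervalIntegral.integral_eq_sub_of_hasDerivAt_of_le h hcont hderiv]
  · simp [fluxK_self]
  · have := continuous_softplus
    exact Continuous.intervalIntegrable (by fun_prop) _ _

lemma critF_eq_fluxF {a ρ : ℝ} (hρ : 0 < ρ) (h : Real.log ρ < a) :
    critF a ρ = fluxF (softplus a) (Real.log (1 + ρ)) := by
  rw [critF, integral_inv_sqrt_softplus h, softplus_log hρ]

lemma log_one_add_lt_softplus {a ρ : ℝ} (hρ : 0 < ρ) (h : Real.log ρ < a) :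
    Real.log (1 + ρ) < softplus a := by
  rw [← softplus_log hρ]
  exact strictMono_softplus h

lemma log_one_add_pos {ρ : ℝ} (hρ : 0 < ρ) : 0 < Real.log (1 + ρ) := Real.log_pos (by linarith)

lemma hasDerivAt_critF {a ρ : ℝ} (hρ : 0 < ρ) (h : Real.log ρ < a) :
    HasDerivAt (fun a => critF a ρ)
      (fluxG (softplus a) (Real.log (1 + ρ)) * (Real.exp a / (1 + Real.exp a))) a := by
  refine ((hasDerivAt_fluxF_left (log_one_add_pos hρ) (log_one_add_lt_softplus hρ h)).comp a
    (hasDerivAt_softplus a)).congr_of_eventuallyEq ?_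
  filter_upwards [lt_mem_nhds h] with a' ha'
  exact critF_eq_fluxF hρ ha'

lemma mem_decreasingSet {ρ : ℝ} :
    ρ ∈ decreasingSet ↔ 0 < ρ ∧ ∃ α, Real.log (1 + ρ) < α ∧ fluxG α (Real.log (1 + ρ)) < 0 := by
  refine and_congr_right fun hρ => ⟨?_, ?_⟩
  · rintro ⟨a, ha, hd⟩
    rw [(hasDerivAt_critF hρ ha).deriv] at hd
    exact ⟨softplus a, log_one_add_lt_softplus hρ ha, neg_of_mul_neg_left hd (by positivity)⟩
  · rintro ⟨α, hα, hd⟩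
    obtain ⟨a, rfl⟩ := exists_softplus_eq ((log_one_add_pos hρ).trans hα)
    have ha : Real.log ρ < a := by
      rwa [← softplus_log hρ, strictMono_softplus.lt_iff_lt] at hα
    refine ⟨a, ha, ?_⟩
    rw [(hasDerivAt_critF hρ ha).deriv]
    exact mul_neg_of_neg_of_pos hd (by positivity)

/-! ### Estimates for `fluxF` and its derivative -/

/-- A coercivity bound from `wt > 1`. It makes `F` unbounded in `α` and confines the solutions of `F
= 2√β` to `α - ω ≤ β`. -/
lemma two_sqrt_le_fluxF {α ω : ℝ} (hω : 0 < ω) (h : ω ≤ α) : 2 * √(α - ω) ≤ fluxF α ω := by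
  have hα := hω.trans_le h
  have : (1 : ℝ) ≤ parAvg (fun _ => 1) wt α ω := by
    have := intervalIntegral.integral_mono_on (a := 0) (b := 1) (f := fun _ => (1 : ℝ))
      (g := fun t => 1 * wt (α * (1 - t ^ 2) + ω * t ^ 2)) zero_le_one
      intervalIntegrable_const
      (intervalIntegrable_parAvg continuousOn_wt continuous_const hα hω) (fun t ht => by
        rw [one_mul]
        exact (one_lt_wt (hω.trans_le (parAvg_mem h le_rfl le_rfl h ht).1)).le)
    simpa [parAvg] using this
  exact le_mul_of_one_le_right (by positivity) this

lemma fluxF_pos {α ω : ℝ} (hω : 0 < ω) (h : ω < α) : 0 < fluxF α ω :=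
  (mul_pos two_pos (Real.sqrt_pos.2 (sub_pos.2 h))).trans_le (two_sqrt_le_fluxF hω h.le)

lemma tendsto_fluxF_atTop {ω : ℝ} (hω : 0 < ω) : Tendsto (fun α => fluxF α ω) atTop atTop := by
  have h : Tendsto (fun α => 2 * √(α - ω)) atTop atTop :=
    (Real.tendsto_sqrt_atTop.comp (tendsto_atTop_add_const_right _ (-ω) tendsto_id)).const_mul_atTop
      two_pos
  refine tendsto_atTop_mono' _ ?_ h
  filter_upwards [eventually_ge_atTop ω] with α hα
  exact two_sqrt_le_fluxF hω hα

lemma sqrt_mul_fluxG {α ω : ℝ} (h : ω < α) :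
    √(α - ω) * fluxG α ω = wt ω + 2 * (α - ω) * parAvg (fun _ => 1) wt₁ α ω := by
  have hs : 0 < √(α - ω) := Real.sqrt_pos.2 (sub_pos.2 h)
  have hsq : √(α - ω) ^ 2 = α - ω := Real.sq_sqrt (sub_pos.2 h).le
  rw [fluxG, abelTransform]
  generalize √(α - ω) = s at *
  rw [← hsq]
  field_simp

/-- The factor `wt²` is frozen at `ω`, where it is largest, and `1 - t² ≥ 1 - t` replaces the
remaining exponential by one that integrates in closed form. -/
lemma neg_parAvg_wt₁_le {m : ℝ → ℝ} (hm : Continuous m) (hm0 : ∀ t ∈ Set.Icc (0 : ℝ) 1, 0 ≤ m t)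
    {α ω : ℝ} (hω : 0 < ω) (h : ω ≤ α) :
    -parAvg m wt₁ α ω ≤ Real.exp (-ω) * wt ω ^ 2 *
      ∫ t in (0 : ℝ)..1, m t * Real.exp (-((α - ω) * (1 - t))) := by
  rw [parAvg, ← intervalIntegral.integral_neg, ← intervalIntegral.integral_const_mul]
  refine intervalIntegral.integral_mono_on zero_le_one
    (intervalIntegrable_parAvg continuousOn_wt₁ hm (hω.trans_le h) hω).neg
    (Continuous.intervalIntegrable (by fun_prop) _ _) fun t ht => ?_
  have h1 := neg_wt₁_le hω (parAvg_mem h le_rfl le_rfl h ht).1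
  have h2 : Real.exp (-(α * (1 - t ^ 2) + ω * t ^ 2)) ≤
      Real.exp (-ω) * Real.exp (-((α - ω) * (1 - t))) := by
    rw [← Real.exp_add, Real.exp_le_exp]
    nlinarith [mul_nonneg (sub_nonneg.2 h) (mul_nonneg ht.1 (sub_nonneg.2 ht.2))]
  have h3 := mul_le_mul_of_nonneg_left
    (h1.trans (mul_le_mul_of_nonneg_right h2 (sq_nonneg (wt ω)))) (hm0 t ht)
  linarith

lemma integral_mul_exp_le_one (L : ℝ) :
    L * ∫ t in (0 : ℝ)..1, (1 : ℝ) * Real.exp (-(L * (1 - t))) ≤ 1 := by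
  rw [← intervalIntegral.integral_const_mul, intervalIntegral.integral_eq_sub_of_hasDerivAt
    (f := fun t => Real.exp (-(L * (1 - t))))]
  · simp
    positivity
  · intro t _
    convert! (((hasDerivAt_id t).const_sub 1).const_mul L).neg.exp using 1
    simp
    ring
  · exact Continuous.intervalIntegrable (by fun_prop) _ _

lemma integral_one_sub_mul_exp_le {L : ℝ} (hL : 0 < L) :
    L * ∫ t in (0 : ℝ)..1, (1 - t) * Real.exp (-(L * (1 - t))) ≤ 1 / L := by
  rw [← intervalIntegral.integral_const_mul, intervalIntegral.integral_eq_sub_of_hasDerivAt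
    (f := fun t => (1 - t + 1 / L) * Real.exp (-(L * (1 - t))))]
  · simp
    positivity
  · intro t _
    convert! (((hasDerivAt_id t).const_sub 1).add_const (1 / L)).mul
      (((hasDerivAt_id t).const_sub 1).const_mul L).neg.exp using 1
    simp
    field_simp
    ring
  · exact Continuous.intervalIntegrable (by fun_prop) _ _

lemma exp_neg_mul_wt (ω : ℝ) (hω : 0 < ω) : Real.exp (-ω) * wt ω = 1 / (Real.exp ω - 1) := by
  have := Real.add_one_lt_exp hω.ne'
  rw [wt, Real.exp_neg]
  have : 1 - (Real.exp ω)⁻¹ = (Real.exp ω - 1) / Real.exp ω := by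
    field_simp
  rw [this]
  field_simp

/-- `fluxG` is positive close to the diagonal. -/
lemma fluxG_pos_of_near {α ω : ℝ} (hω : 0 < ω) (h : ω < α)
    (hL : 2 * (α - ω) < Real.exp ω - 1) : 0 < fluxG α ω := by
  have hpos : 0 < √(α - ω) := Real.sqrt_pos.2 (sub_pos.2 h)
  refine pos_of_mul_pos_right (a := √(α - ω)) ?_ hpos.le
  rw [sqrt_mul_fluxG h]
  have hb := neg_parAvg_wt₁_le (m := fun _ => 1) continuous_const (fun _ _ => zero_le_one) hω h.le
  have hI : ∫ t in (0 : ℝ)..1, (1 : ℝ) * Real.exp (-((α - ω) * (1 - t))) ≤ 1 := by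
    have := intervalIntegral.integral_mono_on (μ := volume) (a := 0) (b := 1)
      (g := fun _ => (1 : ℝ)) (f := fun t => 1 * Real.exp (-((α - ω) * (1 - t)))) zero_le_one
      (Continuous.intervalIntegrable (by fun_prop) _ _) intervalIntegrable_const (fun t ht => by
        rw [one_mul, Real.exp_le_one_iff]
        nlinarith [mul_nonneg (sub_nonneg.2 h.le) (sub_nonneg.2 ht.2)])
    simpa using this
  have hw := wt_pos hω
  have hC : 0 < Real.exp (-ω) * wt ω ^ 2 := by positivity
  have h1 : -parAvg (fun _ => 1) wt₁ α ω ≤ Real.exp (-ω) * wt ω ^ 2 :=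
    hb.trans (mul_le_of_le_one_right hC.le hI)
  have h2 : 2 * (α - ω) * (Real.exp (-ω) * wt ω ^ 2) < wt ω := by
    have he : 0 < Real.exp ω - 1 := by linarith [Real.add_one_lt_exp hω.ne']
    have : 2 * (α - ω) * (Real.exp (-ω) * wt ω) < 1 := by
      rw [exp_neg_mul_wt ω hω, mul_one_div, div_lt_one he]
      exact hL
    calc _ = 2 * (α - ω) * (Real.exp (-ω) * wt ω) * wt ω := by ring
      _ < 1 * wt ω := mul_lt_mul_of_pos_right this hw
      _ = wt ω := one_mul _
  nlinarith [mul_le_mul_of_nonneg_left h1 (by linarith : 0 ≤ 2 * (α - ω))]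

/-- `fluxG` is positive for large `ω`. -/
lemma fluxG_pos_of_large_right {α ω : ℝ} (hω : 0 < ω) (h : ω < α) (hL : 2 < Real.exp ω - 1) :
    0 < fluxG α ω := by
  have hpos : 0 < √(α - ω) := Real.sqrt_pos.2 (sub_pos.2 h)
  refine pos_of_mul_pos_right (a := √(α - ω)) ?_ hpos.le
  rw [sqrt_mul_fluxG h]
  have hb := neg_parAvg_wt₁_le (m := fun _ => 1) continuous_const (fun _ _ => zero_le_one) hω h.le
  have hI := integral_mul_exp_le_one (α - ω)
  set J := ∫ t in (0 : ℝ)..1, (1 : ℝ) * Real.exp (-((α - ω) * (1 - t)))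
  have hw := wt_pos hω
  have hC : 0 < Real.exp (-ω) * wt ω ^ 2 := by positivity
  have h2 : 2 * (Real.exp (-ω) * wt ω ^ 2) < wt ω := by
    have : 2 * (Real.exp (-ω) * wt ω) < 1 := by
      rw [exp_neg_mul_wt ω hω, mul_one_div, div_lt_one (by linarith)]
      exact hL
    calc _ = 2 * (Real.exp (-ω) * wt ω) * wt ω := by ring
      _ < 1 * wt ω := mul_lt_mul_of_pos_right this hw
      _ = wt ω := one_mul _
  nlinarith [mul_le_mul_of_nonneg_left hb (by linarith : 0 ≤ 2 * (α - ω)),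
    mul_le_mul_of_nonneg_left hI hC.le]

/-- `fluxG` is positive for large `α`. -/
lemma fluxG_pos_of_large_left {α ω : ℝ} (hω : 0 < ω) (h : ω < α)
    (hL : 2 * (Real.exp (-ω) * wt ω ^ 2) < α - ω) : 0 < fluxG α ω := by
  have hpos : 0 < √(α - ω) := Real.sqrt_pos.2 (sub_pos.2 h)
  refine pos_of_mul_pos_right (a := √(α - ω)) ?_ hpos.le
  rw [sqrt_mul_fluxG h]
  have hα := hω.trans h
  have hb := neg_parAvg_wt₁_le (m := fun t => 1 - t) (by fun_prop) (fun _ ht => sub_nonneg.2 ht.2)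
    hω h.le
  have hI := integral_one_sub_mul_exp_le (sub_pos.2 h)
  set J := ∫ t in (0 : ℝ)..1, (1 - t) * Real.exp (-((α - ω) * (1 - t)))
  have hC : 0 < Real.exp (-ω) * wt ω ^ 2 := by
    have := wt_pos hω
    positivity
  -- In `1 = t + (1 - t)` the weight `t` integrates exactly, to `(wt α - wt ω)/(2(α - ω))`. This
  -- turns the main term `wt ω` into `wt α > 1`, and the weight `1 - t` leaves an error of order
  -- `1/(α - ω)`.
  have hsplit : parAvg (fun _ => 1) wt₁ α ω =
      parAvg (fun t => t * 1) wt₁ α ω + parAvg (fun t => 1 - t) wt₁ α ω := by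
    rw [← parAvg_add continuousOn_wt₁ (by fun_prop) (by fun_prop) hα hω]
    congr 1; ext; ring
  have hparts := parAvg_by_parts (m := fun _ => 1) (m' := fun _ => 0) (fun _ => hasDerivAt_wt)
    continuousOn_wt₁ (fun t => hasDerivAt_const t 1) continuous_const hα hω
  have hzero : parAvg (fun _ => 0) wt α ω = 0 := by simp [parAvg]
  rw [hzero] at hparts
  have h1 := one_lt_wt hα
  have h3 : 2 * (Real.exp (-ω) * wt ω ^ 2) * (1 / (α - ω)) < 1 := by
    rwa [mul_one_div, div_lt_one (sub_pos.2 h)]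
  rw [hsplit]
  nlinarith [mul_le_mul_of_nonneg_left hb (by linarith : 0 ≤ 2 * (α - ω)),
    mul_le_mul_of_nonneg_left hI hC.le]

lemma strictMonoOn_fluxG (α : ℝ) : StrictMonoOn (fun ω => fluxG α ω) (Set.Ioo 0 α) := by
  refine strictMonoOn_of_deriv_pos (convex_Ioo 0 α) (fun ω hω =>
    (hasDerivAt_fluxG_right hω.1 hω.2).continuousAt.continuousWithinAt) fun ω hω => ?_
  rw [interior_Ioo] at hω
  rw [(hasDerivAt_fluxG_right hω.1 hω.2).deriv]
  have := sub_pos.2 hω.2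
  have := wt_pos hω.1
  positivity

/-- Since `wt ω ≥ 1/ω`, the `ω`-derivative of `fluxG` is at least `c/ω`. Comparison with `c log ω`
sends `fluxG α ω` to `-∞` as `ω → 0`. -/
lemma exists_fluxG_neg {α : ℝ} (hα : 0 < α) : ∃ ω, 0 < ω ∧ ω < α ∧ fluxG α ω < 0 := by
  set c := 1 / (2 * (α * √α)) with hc
  have hc0 : 0 < c := by have := Real.sqrt_pos.2 hα; positivity
  have hmono : MonotoneOn (fun ω => fluxG α ω - c * Real.log ω) (Set.Ioo 0 α) := by
    have hd : ∀ ω ∈ Set.Ioo 0 α, HasDerivAt (fun ω => fluxG α ω - c * Real.log ω)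
        (wt ω / (2 * ((α - ω) * √(α - ω))) - c * ω⁻¹) ω := fun ω hω =>
      (hasDerivAt_fluxG_right hω.1 hω.2).sub ((Real.hasDerivAt_log hω.1.ne').const_mul c)
    refine monotoneOn_of_deriv_nonneg (convex_Ioo 0 α)
      (fun ω hω => (hd ω hω).continuousAt.continuousWithinAt)
      (fun ω hω => (hd ω (interior_subset hω)).differentiableAt.differentiableWithinAt)
      fun ω hω => ?_
    replace hω := interior_subset hω
    rw [(hd ω hω).deriv, sub_nonneg, hc, div_mul_eq_mul_div, one_mul]
    have h1 := sub_pos.2 hω.2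
    have h2 := Real.sqrt_pos.2 h1
    have h4 := wt_pos hω.1
    apply div_le_div₀ h4.le (inv_le_wt hω.1) (by positivity)
    have : α - ω ≤ α := by linarith [hω.1]
    gcongr
  have htend : Tendsto (fun ω => c * Real.log ω + (fluxG α (α / 2) - c * Real.log (α / 2)))
      (𝓝[>] 0) atBot :=
    tendsto_atBot_add_const_right _ _ (Real.tendsto_log_nhdsGT_zero.const_mul_atBot hc0)
  obtain ⟨ω, h1, h2⟩ := ((htend.eventually (eventually_lt_atBot 0)).and
    (Ioo_mem_nhdsGT (half_pos hα))).exists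
  refine ⟨ω, h2.1, by linarith [h2.2], ?_⟩
  have := hmono ⟨h2.1, by linarith [h2.2]⟩ ⟨half_pos hα, half_lt_self hα⟩ h2.2.le
  simp only at this
  linarith

lemma fluxG_eq_fderiv {p : ℝ × ℝ} (h₂ : 0 < p.2) (h : p.2 < p.1) :
    fluxG p.1 p.2 = fderiv ℝ (fun p : ℝ × ℝ => fluxF p.1 p.2) p (1, 0) := by
  have h1 := (analyticAt_fluxF h₂ h).differentiableAt.hasFDerivAt
  have h2 : HasDerivAt (fun α : ℝ => (α, p.2)) (1, 0) p.1 :=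
    (hasDerivAt_id p.1).prodMk (hasDerivAt_const _ _)
  exact (hasDerivAt_fluxF_left h₂ h).unique (h1.comp_hasDerivAt (f := fun α => (α, p.2)) p.1 h2)

lemma isOpen_fluxDomain : IsOpen {p : ℝ × ℝ | 0 < p.2 ∧ p.2 < p.1} :=
  (isOpen_lt continuous_const continuous_snd).inter (isOpen_lt continuous_snd continuous_fst)

lemma continuousAt_fluxG {p : ℝ × ℝ} (h₂ : 0 < p.2) (h : p.2 < p.1) :
    ContinuousAt (fun p : ℝ × ℝ => fluxG p.1 p.2) p := by
  have h1 := (analyticAt_fluxF h₂ h).fderiv.continuousAt.clm_apply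
    (continuousAt_const (y := ((1 : ℝ), (0 : ℝ))))
  refine h1.congr ?_
  filter_upwards [isOpen_fluxDomain.mem_nhds ⟨h₂, h⟩] with q hq
  exact (fluxG_eq_fderiv hq.1 hq.2).symm

/-! ### The critical value -/

lemma log_one_add_lt {ρ ρ' : ℝ} (hρ : 0 < ρ) (h : ρ < ρ') : Real.log (1 + ρ) < Real.log (1 + ρ') :=
  Real.log_lt_log (by linarith) (by linarith)

lemma exp_log_one_add {ρ : ℝ} (hρ : 0 < ρ) : Real.exp (Real.log (1 + ρ)) = 1 + ρ :=
  Real.exp_log (by linarith)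

lemma decreasingSet_nonempty : decreasingSet.Nonempty := by
  obtain ⟨ω, h0, h1, h2⟩ := exists_fluxG_neg one_pos
  have h3 : Real.log (1 + (Real.exp ω - 1)) = ω := by simp
  refine ⟨Real.exp ω - 1, mem_decreasingSet.2 ⟨by linarith [Real.add_one_lt_exp h0.ne'], 1, ?_⟩⟩
  rw [h3]
  exact ⟨h1, h2⟩

lemma bddAbove_decreasingSet : BddAbove decreasingSet := by
  refine ⟨2, fun ρ hρ => ?_⟩
  obtain ⟨h0, α, h1, h2⟩ := mem_decreasingSet.1 hρ
  by_contra! h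
  refine h2.not_gt (fluxG_pos_of_large_right (log_one_add_pos h0) h1 ?_)
  rw [exp_log_one_add h0]
  linarith

lemma isLUB_rhoC : IsLUB decreasingSet rhoC :=
  isLUB_csSup decreasingSet_nonempty bddAbove_decreasingSet

lemma rhoC_pos : 0 < rhoC := by
  obtain ⟨ρ, hρ⟩ := decreasingSet_nonempty
  exact hρ.1.trans_le (isLUB_rhoC.1 hρ)

/-- The critical value in the coordinate `ω = log (1 + ρ)`. -/
noncomputable def omegaC : ℝ := Real.log (1 + rhoC)

lemma omegaC_pos : 0 < omegaC := log_one_add_pos rhoC_pos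

lemma fluxG_pos_of_gt {α ω : ℝ} (hω : omegaC < ω) (h : ω < α) : 0 < fluxG α ω := by
  obtain ⟨ω', h1, h2⟩ := exists_between hω
  have h0 := omegaC_pos.trans h1
  refine lt_of_le_of_lt ?_ (strictMonoOn_fluxG α ⟨h0, h2.trans h⟩ ⟨h0.trans h2, h⟩ h2)
  by_contra! hneg
  have hexp : Real.log (1 + (Real.exp ω' - 1)) = ω' := by simp
  have hmem : Real.exp ω' - 1 ∈ decreasingSet := by
    refine mem_decreasingSet.2 ⟨by linarith [Real.add_one_lt_exp h0.ne'], α, ?_⟩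
    rw [hexp]
    exact ⟨h2.trans h, hneg⟩
  have := isLUB_rhoC.1 hmem
  have h3 := Real.exp_lt_exp.2 h1
  rw [omegaC, exp_log_one_add rhoC_pos] at h3
  linarith

/-- A negative value would persist slightly to the right of `omegaC` by continuity. -/
lemma fluxG_nonneg {α : ℝ} (h : omegaC < α) : 0 ≤ fluxG α omegaC := by
  by_contra! hneg
  have h1 : ∀ᶠ ω in 𝓝 omegaC, fluxG α ω < 0 :=
    (hasDerivAt_fluxG_right omegaC_pos h).continuousAt.eventually (gt_mem_nhds hneg)
  obtain ⟨ω, h2, h3⟩ := ((h1.filter_mono nhdsWithin_le_nhds).and (Ioo_mem_nhdsGT h)).exists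
  exact h2.not_gt (fluxG_pos_of_gt h3.1 h3.2)

/-- Take `ρ_n → rhoC` in the set and `α_n` with `fluxG` negative. The positivity estimates keep
`α_n` bounded and away from the diagonal, so a subsequence converges to some `α > omegaC` with
`fluxG ≤ 0`; the opposite inequality is `fluxG_nonneg`. -/
lemma exists_fluxG_eq_zero : ∃ α, omegaC < α ∧ fluxG α omegaC = 0 := by
  obtain ⟨ρ, -, htend, hmem⟩ := exists_seq_tendsto_sSup decreasingSet_nonempty
    bddAbove_decreasingSet
  have hρ : ∀ n, 0 < ρ n := fun n => (hmem n).1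
  choose α hα hneg using fun n => (mem_decreasingSet.1 (hmem n)).2
  set ω : ℕ → ℝ := fun n => Real.log (1 + ρ n) with hωdef
  have hωpos : ∀ n, 0 < ω n := fun n => log_one_add_pos (hρ n)
  have hωle : ∀ n, ω n ≤ omegaC := fun n =>
    Real.log_le_log (by linarith [hρ n]) (by linarith [isLUB_rhoC.1 (hmem n)])
  have hωtend : Tendsto ω atTop (𝓝 omegaC) :=
    (Real.continuousAt_log (by linarith [rhoC_pos])).tendsto.comp (htend.const_add 1)
  set ω₀ := omegaC / 2 with hω₀
  have hω₀pos : 0 < ω₀ := half_pos omegaC_pos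
  set M := ω₀ + 2 * (Real.exp (-ω₀) * wt ω₀ ^ 2) with hM
  set c := (Real.exp ω₀ - 1) / 2 with hc
  have hcpos : 0 < c := half_pos (by linarith [Real.add_one_lt_exp hω₀pos.ne'])
  have hbox : ∀ᶠ n in atTop, (α n, ω n) ∈
      (Set.Icc 0 M ×ˢ Set.Icc ω₀ omegaC) ∩ {p : ℝ × ℝ | p.2 + c ≤ p.1} := by
    filter_upwards [hωtend.eventually (lt_mem_nhds (half_lt_self omegaC_pos))] with n hn
    refine ⟨⟨⟨((hωpos n).trans (hα n)).le, ?_⟩, hn.le, hωle n⟩, ?_⟩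
    · by_contra! h
      -- Monotonicity in `ω` transfers the negative value to the fixed `ω₀`, which makes the bound
      -- `M` uniform in `n`.
      have h1 := strictMonoOn_fluxG (α n) ⟨hω₀pos, hn.trans (hα n)⟩ ⟨hωpos n, hα n⟩ hn
      refine (h1.trans (hneg n)).not_gt (fluxG_pos_of_large_left hω₀pos (hn.trans (hα n)) ?_)
      linarith
    · by_contra! h
      refine (hneg n).not_gt (fluxG_pos_of_near (hωpos n) (hα n) ?_)
      have : Real.exp ω₀ ≤ Real.exp (ω n) := Real.exp_le_exp.2 hn.le
      have h' : α n < ω n + c := not_le.1 h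
      change 2 * (α n - ω n) < Real.exp (ω n) - 1
      linarith
  have hcomp : IsCompact ((Set.Icc 0 M ×ˢ Set.Icc ω₀ omegaC) ∩ {p : ℝ × ℝ | p.2 + c ≤ p.1}) :=
    (isCompact_Icc.prod isCompact_Icc).inter_right
      (isClosed_le (by fun_prop) (by fun_prop))
  obtain ⟨p, hp, φ, hφ, hlim⟩ := hcomp.tendsto_subseq' hbox.frequently
  have hp2 : p.2 = omegaC := tendsto_nhds_unique
    ((continuous_snd.tendsto p).comp hlim) (hωtend.comp hφ.tendsto_atTop)
  have hp1 : omegaC < p.1 := by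
    have : p.2 + c ≤ p.1 := hp.2
    linarith
  refine ⟨p.1, hp1, le_antisymm ?_ (fluxG_nonneg hp1)⟩
  rw [← hp2] at hp1 ⊢
  have hlim2 := (continuousAt_fluxG (hp2 ▸ omegaC_pos) hp1).tendsto.comp hlim
  exact le_of_tendsto hlim2 (Eventually.of_forall fun n => (hneg (φ n)).le)

lemma strictMonoOn_fluxF_of_gt {ω : ℝ} (hω : omegaC < ω) :
    StrictMonoOn (fun α => fluxF α ω) (Set.Ioi ω) := by
  have h0 := omegaC_pos.trans hω
  refine strictMonoOn_of_deriv_pos (convex_Ioi ω) (fun α hα =>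
    (hasDerivAt_fluxF_left h0 hα).continuousAt.continuousWithinAt) fun α hα => ?_
  rw [interior_Ioi] at hα
  rw [(hasDerivAt_fluxF_left h0 hα).deriv]
  exact fluxG_pos_of_gt hω hα

/-- Here the derivative does vanish somewhere. If `F` were constant on an interval, the identity
theorem would make it constant on the whole half-line, although it tends to infinity. -/
lemma strictMonoOn_fluxF_omegaC : StrictMonoOn (fun α => fluxF α omegaC) (Set.Ioi omegaC) := by
  have hmono : MonotoneOn (fun α => fluxF α omegaC) (Set.Ioi omegaC) := by
    refine monotoneOn_of_deriv_nonneg (convex_Ioi _) (fun α hα =>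
      (hasDerivAt_fluxF_left omegaC_pos hα).continuousAt.continuousWithinAt)
      (fun α hα => (hasDerivAt_fluxF_left omegaC_pos
        (interior_subset hα)).differentiableAt.differentiableWithinAt) fun α hα => ?_
    rw [interior_Ioi] at hα
    rw [(hasDerivAt_fluxF_left omegaC_pos hα).deriv]
    exact fluxG_nonneg hα
  intro x hx y hy hxy
  refine lt_of_le_of_ne (hmono hx hy hxy.le) fun heq => ?_
  have hconst : ∀ z ∈ Set.Icc x y, fluxF z omegaC = fluxF x omegaC := fun z hz =>
    le_antisymm ((hmono (lt_of_lt_of_le hx hz.1) hy hz.2).trans heq.ge)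
      (hmono hx (lt_of_lt_of_le hx hz.1) hz.1)
  have han : AnalyticOnNhd ℝ (fun α => fluxF α omegaC) (Set.Ioi omegaC) := fun α hα =>
    (analyticAt_fluxF (p := (α, omegaC)) omegaC_pos hα).comp
      (f := fun α => (α, omegaC)) (analyticAt_id.prod analyticAt_const)
  have hmid : (x + y) / 2 ∈ Set.Ioo x y := ⟨by linarith, by linarith⟩
  have heqOn := han.eqOn_of_preconnected_of_eventuallyEq (analyticOnNhd_const (v := fluxF x omegaC))
    isPreconnected_Ioi (lt_trans hx hmid.1) (by
      filter_upwards [Ioo_mem_nhds hmid.1 hmid.2] with z hz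
      exact hconst z ⟨hz.1.le, hz.2.le⟩)
  obtain ⟨z, hz1, hz2⟩ := (((tendsto_fluxF_atTop omegaC_pos).eventually
    (eventually_gt_atTop (fluxF x omegaC))).and (eventually_gt_atTop omegaC)).exists
  exact hz1.ne' (heqOn hz2)

lemma strictMonoOn_fluxF {ω : ℝ} (hω : omegaC ≤ ω) :
    StrictMonoOn (fun α => fluxF α ω) (Set.Ioi ω) := by
  rcases hω.eq_or_lt with rfl | h
  · exact strictMonoOn_fluxF_omegaC
  · exact strictMonoOn_fluxF_of_gt h

/-! ### The transfer operator of the process -/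

/-- One step of the process, in the logarithmic coordinate `h`, with Gaussian increments of mean
`-v / 2` and variance `v`. -/
noncomputable def transfer (v : ℝ≥0) (g : ℝ → ENNReal) (h : ℝ) : ENNReal :=
  ENNReal.ofReal (1 + Real.exp h) * ∫⁻ z, g (h + z) ∂(gaussianReal (-v / 2) v)

lemma measurable_transfer (v : ℝ≥0) {g : ℝ → ENNReal} (hg : Measurable g) :
    Measurable (transfer v g) := by
  unfold transfer
  refine Measurable.mul (by fun_prop) ?_
  exact Measurable.lintegral_prod_right' (f := fun p : ℝ × ℝ => g (p.1 + p.2)) (by fun_prop)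

lemma transfer_mono (v : ℝ≥0) {g₁ g₂ : ℝ → ENNReal} {h : ℝ} (hg : ∀ z, g₁ (h + z) ≤ g₂ (h + z)) :
    transfer v g₁ h ≤ transfer v g₂ h :=
  mul_le_mul_right (lintegral_mono fun z => hg z) _

lemma lintegral_exp_gaussian (v : ℝ≥0) (p : ℝ) :
    ∫⁻ z, ENNReal.ofReal (Real.exp (p * z)) ∂(gaussianReal (-v / 2) v) =
      ENNReal.ofReal (Real.exp (v * (p ^ 2 - p) / 2)) := by
  have h := congrFun (mgf_id_gaussianReal (μ := -v / 2) (v := v)) p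
  rw [← ofReal_integral_eq_lintegral_ofReal (integrable_exp_mul_gaussianReal p)
    (Eventually.of_forall fun _ => (Real.exp_pos _).le)]
  congr 1
  simp only [mgf, id] at h
  rw [h]
  congr 1
  ring

/-- Exponentials are the test functions for both bounds: `transfer` acts on them explicitly, through
the Gaussian moment generating function. -/
lemma transfer_exp (v : ℝ≥0) (A p h : ℝ) :
    transfer v (fun x => ENNReal.ofReal (Real.exp (A + p * (x - h)))) h =
      ENNReal.ofReal (Real.exp (softplus h + A + v * (p ^ 2 - p) / 2)) := by
  simp only [transfer, add_sub_cancel_left, Real.exp_add A]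
  simp_rw [ENNReal.ofReal_mul (Real.exp_pos A).le]
  rw [lintegral_const_mul _ (by fun_prop), lintegral_exp_gaussian, ← exp_softplus,
    ← ENNReal.ofReal_mul (Real.exp_pos _).le, ← ENNReal.ofReal_mul (Real.exp_pos _).le,
    ← Real.exp_add, ← Real.exp_add, add_assoc]

lemma transfer_const (v : ℝ≥0) (A h : ℝ) :
    transfer v (fun _ => ENNReal.ofReal (Real.exp A)) h =
      ENNReal.ofReal (Real.exp (softplus h + A)) := by
  simpa using transfer_exp v A 0 h

/-! ### Lower bound -/

/-- Convexity of `exp` between `0` and `h - b`, with weights `1 - s` and `s`. -/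
lemma softplus_tangent (b h : ℝ) :
    softplus b + Real.exp b / (1 + Real.exp b) * (h - b) ≤ softplus h := by
  have hb := Real.exp_pos b
  set s := Real.exp b / (1 + Real.exp b) with hs
  have hs0 : 0 ≤ s := by positivity
  have hs1 : 1 - s = 1 / (1 + Real.exp b) := by rw [hs]; field_simp; ring
  have h1 := convexOn_exp.2 (Set.mem_univ 0) (Set.mem_univ (h - b))
    (by rw [hs1]; positivity : 0 ≤ 1 - s) hs0 (by ring)
  simp only [smul_eq_mul, mul_zero, zero_add, Real.exp_zero, mul_one] at h1
  rw [← Real.exp_le_exp, Real.exp_add, exp_softplus, exp_softplus]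
  calc _ ≤ (1 + Real.exp b) * (1 - s + s * Real.exp (h - b)) := by gcongr
    _ = 1 + Real.exp b * Real.exp (h - b) := by rw [hs1, hs]; field_simp
    _ = 1 + Real.exp h := by rw [← Real.exp_add]; ring_nf

/-- Any path `b` yields a lower bound by its discrete action. The estimate is carried as an
exponential in `h`, with an uncontrolled slope `p` that disappears at `h = b 0`. Each step uses the
tangent of `softplus` at the current point and the Legendre inequality for the Gaussian step, which
is a completed square in `p`. -/
lemma le_iterate_transfer {v : ℝ≥0} (hv : 0 < v) (n : ℕ) (b : ℕ → ℝ) : ∃ p : ℝ, ∀ h,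
    ENNReal.ofReal (Real.exp (∑ i ∈ Finset.range n,
      (softplus (b i) - (b (i + 1) - b i + v / 2) ^ 2 / (2 * v)) + p * (h - b 0))) ≤
    (transfer v)^[n] (fun _ => 1) h := by
  induction n generalizing b with
  | zero => exact ⟨0, by simp⟩
  | succ n ih =>
    obtain ⟨p, hp⟩ := ih (fun i => b (i + 1))
    set B := ∑ i ∈ Finset.range n,
      (softplus (b (i + 1)) - (b (i + 1 + 1) - b (i + 1) + v / 2) ^ 2 / (2 * v)) with hB
    refine ⟨Real.exp (b 0) / (1 + Real.exp (b 0)) + p, fun h => ?_⟩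
    have h1 : transfer v (fun x => ENNReal.ofReal (Real.exp (B + p * (h - b 1) + p * (x - h)))) h ≤
        transfer v ((transfer v)^[n] fun _ => 1) h :=
      transfer_mono v fun z => by
        refine le_of_eq_of_le ?_ (hp (h + z))
        congr 2
        simp only [zero_add]
        ring
    rw [Function.iterate_succ_apply']
    refine le_trans ?_ h1
    rw [transfer_exp]
    apply ENNReal.ofReal_le_ofReal
    rw [Real.exp_le_exp, Finset.sum_range_succ', ← hB]
    have h2 := softplus_tangent (b 0) h
    have h3 : p * (b 1 - b 0) ≤
        v * (p ^ 2 - p) / 2 + (b (0 + 1) - b 0 + v / 2) ^ 2 / (2 * v) := by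
      have hv' : (0 : ℝ) < v := hv
      have : v * (p ^ 2 - p) / 2 + (b (0 + 1) - b 0 + v / 2) ^ 2 / (2 * v) - p * (b 1 - b 0) =
          (v * p - (b 1 - b 0 + v / 2)) ^ 2 / (2 * v) := by
        rw [zero_add]; field_simp; ring
      have h4 : 0 ≤ (v * p - (b 1 - b 0 + v / 2)) ^ 2 / (2 * v) := by positivity
      linarith
    linarith

/-- The slope function of the action with maximal height `α`. -/
noncomputable def pathSpeed (α x : ℝ) : ℝ := √(α - softplus x)

lemma continuous_pathSpeed (α : ℝ) : Continuous (pathSpeed α) := by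
  have := continuous_softplus
  unfold pathSpeed
  fun_prop

lemma antitone_pathSpeed (α : ℝ) : Antitone (pathSpeed α) := fun _ _ h =>
  Real.sqrt_le_sqrt (by linarith [strictMono_softplus.monotone h])

lemma pathSpeed_nonneg (α x : ℝ) : 0 ≤ pathSpeed α x := Real.sqrt_nonneg _

lemma intervalIntegrable_pathSpeed (α x y : ℝ) : IntervalIntegrable (pathSpeed α) volume x y :=
  (continuous_pathSpeed α).intervalIntegrable _ _

lemma integral_pathSpeed_le (α x y : ℝ) :
    ∫ t in x..y, pathSpeed α t ≤ pathSpeed α x * (y - x) := by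
  rcases le_total x y with h | h
  · have := intervalIntegral.integral_mono_on h (intervalIntegrable_pathSpeed α x y)
      (intervalIntegrable_const (c := pathSpeed α x)) fun t ht => antitone_pathSpeed α ht.1
    simpa [mul_comm] using this
  · have := intervalIntegral.integral_mono_on h (intervalIntegrable_const (c := pathSpeed α x))
      (intervalIntegrable_pathSpeed α y x) fun t ht => antitone_pathSpeed α ht.2
    rw [intervalIntegral.integral_symm]
    rw [intervalIntegral.integral_const, smul_eq_mul] at this
    linarith

lemma le_integral_pathSpeed (α x y : ℝ) :
    pathSpeed α y * (y - x) ≤ ∫ t in x..y, pathSpeed α t := by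
  have := integral_pathSpeed_le α y x
  rw [intervalIntegral.integral_symm] at this
  linarith

/-- The Euler scheme of the optimal path. -/
noncomputable def eulerPath (α u s : ℝ) : ℕ → ℝ
  | 0 => u
  | i + 1 => eulerPath α u s i + s * pathSpeed α (eulerPath α u s i)

lemma le_eulerPath {α u s : ℝ} (hs : 0 ≤ s) (n : ℕ) : u ≤ eulerPath α u s n := by
  induction n with
  | zero => exact le_rfl
  | succ n ih => exact ih.trans (le_add_of_nonneg_right (mul_nonneg hs (pathSpeed_nonneg _ _)))

/-- A right-endpoint Riemann sum of the decreasing speed lies below its integral. Replacing it by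
the left-endpoint sum costs increments of the speed, which telescope. -/
lemma sum_eulerPath_le {α u s : ℝ} (hs : 0 ≤ s) (n : ℕ) :
    ∑ i ∈ Finset.range n, s * pathSpeed α (eulerPath α u s i) ^ 2 ≤
      (∫ t in u..eulerPath α u s n, pathSpeed α t) +
        s * pathSpeed α u * (pathSpeed α u - pathSpeed α (eulerPath α u s n)) := by
  induction n with
  | zero => simp [eulerPath]
  | succ n ih =>
    rw [Finset.sum_range_succ, ← intervalIntegral.integral_add_adjacent_intervals
      (intervalIntegrable_pathSpeed α u (eulerPath α u s n)) (intervalIntegrable_pathSpeed α _ _)]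
    have h1 := le_integral_pathSpeed α (eulerPath α u s n) (eulerPath α u s (n + 1))
    have h2 := antitone_pathSpeed α (le_eulerPath (α := α) (u := u) hs n)
    have h3 : pathSpeed α (eulerPath α u s (n + 1)) ≤ pathSpeed α (eulerPath α u s n) :=
      antitone_pathSpeed α (le_add_of_nonneg_right (mul_nonneg hs (pathSpeed_nonneg _ _)))
    have h4 : eulerPath α u s (n + 1) - eulerPath α u s n = s * pathSpeed α (eulerPath α u s n) := by
      simp [eulerPath]
    rw [h4] at h1
    nlinarith [mul_nonneg (mul_nonneg hs (sub_nonneg.2 h2)) (sub_nonneg.2 h3)]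

/-- The Euler scheme may overshoot the top `a`. Beyond `a` the square root takes its default value
`0`, so nothing is added. -/
lemma integral_pathSpeed_le_fluxK {a u y : ℝ} (hua : u ≤ a) :
    ∫ t in u..y, pathSpeed (softplus a) t ≤ fluxK (softplus a) (softplus u) := by
  rw [← integral_sqrt_softplus hua]
  change _ ≤ ∫ t in u..a, pathSpeed (softplus a) t
  rw [← intervalIntegral.integral_add_adjacent_intervals
    (intervalIntegrable_pathSpeed (softplus a) u a) (intervalIntegrable_pathSpeed _ a y)]
  have := integral_pathSpeed_le (softplus a) a y
  have h0 : pathSpeed (softplus a) a = 0 := by simp [pathSpeed]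
  rw [h0] at this
  linarith

/-- The action functional, whose maximum over `α` is the Lyapunov exponent. -/
noncomputable def action (α ω β : ℝ) : ℝ := α - fluxK α ω / √β

lemma exp_le_iterate_transfer {β α u : ℝ} (hβ : 0 < β) (hα : softplus u ≤ α) :
    ∃ C : ℝ, ∀ (n : ℕ) (v : ℝ≥0), 0 < n → (v : ℝ) = 2 * β / n ^ 2 →
      ENNReal.ofReal (Real.exp (n * action α (softplus u) β - C)) ≤
        (transfer v)^[n] (fun _ => 1) u := by
  obtain ⟨a, rfl⟩ := exists_softplus_eq ((softplus_pos u).trans_le hα)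
  have hua : u ≤ a := strictMono_softplus.le_iff_le.1 hα
  set w₀ := pathSpeed (softplus a) u
  -- The three terms are the Riemann sum error, the cross term with the drift `-v/2`, and the square
  -- of the drift.
  refine ⟨2 * w₀ ^ 2 + √β * w₀ + β / 4, fun n v hn hv => ?_⟩
  have hn' : (0 : ℝ) < n := Nat.cast_pos.2 hn
  have hn1 : (1 : ℝ) ≤ n := Nat.one_le_cast.2 hn
  have hsβ : 0 < √β := Real.sqrt_pos.2 hβ
  have hβsq : √β ^ 2 = β := Real.sq_sqrt hβ.le
  -- This step size satisfies `s² = 2v`, so a step `s w` has Gaussian cost exactly `w²`, as energy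
  -- conservation requires.
  set s := 2 * √β / n with hs
  have hs0 : 0 ≤ s := by positivity
  have hv0 : 0 < v := by
    rw [← NNReal.coe_pos, hv]
    positivity
  obtain ⟨p, hp⟩ := le_iterate_transfer hv0 n (eulerPath (softplus a) u s)
  refine le_trans ?_ (hp u)
  apply ENNReal.ofReal_le_ofReal
  rw [Real.exp_le_exp]
  set w : ℕ → ℝ := fun i => pathSpeed (softplus a) (eulerPath (softplus a) u s i) with hw
  have hterm : ∀ i, softplus a - 2 * w i ^ 2 - √β * w₀ / n - β / (4 * n ^ 2) ≤
      softplus (eulerPath (softplus a) u s i) - (eulerPath (softplus a) u s (i + 1) -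
        eulerPath (softplus a) u s i + v / 2) ^ 2 / (2 * v) := by
    intro i
    have h1 : eulerPath (softplus a) u s (i + 1) - eulerPath (softplus a) u s i = s * w i := by
      simp [eulerPath, hw]
    have h2 : (s * w i + v / 2) ^ 2 / (2 * v) = w i ^ 2 + √β * w i / n + β / (4 * n ^ 2) := by
      rw [hv, hs]
      nth_rewrite 1 2 3 [← hβsq]
      rw [← hβsq]
      simp only [Real.sqrt_sq hsβ.le]
      field_simp
      ring
    have h3 : w i ≤ w₀ := antitone_pathSpeed _ (le_eulerPath hs0 i)
    have h4 : softplus a - w i ^ 2 ≤ softplus (eulerPath (softplus a) u s i) := by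
      rcases le_total (softplus (eulerPath (softplus a) u s i)) (softplus a) with h | h
      · have : w i ^ 2 = softplus a - softplus (eulerPath (softplus a) u s i) :=
          Real.sq_sqrt (sub_nonneg.2 h)
        linarith
      · have := sq_nonneg (w i)
        linarith
    have h5 : √β * w i / n ≤ √β * w₀ / n := by gcongr
    rw [h1, h2]
    linarith
  have hsum := Finset.sum_le_sum fun i (_ : i ∈ Finset.range n) => hterm i
  have hE := (sum_eulerPath_le (α := softplus a) (u := u) hs0 n).trans (add_le_add
    (integral_pathSpeed_le_fluxK hua) (mul_le_mul_of_nonneg_left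
      (sub_le_self _ (pathSpeed_nonneg _ _)) (mul_nonneg hs0 (pathSpeed_nonneg _ _))))
  rw [← Finset.mul_sum] at hE
  change s * ∑ i ∈ Finset.range n, w i ^ 2 ≤ _ + s * w₀ * w₀ at hE
  simp only [Finset.sum_sub_distrib, ← Finset.mul_sum, Finset.sum_const, Finset.card_range,
    nsmul_eq_mul] at hsum
  have h6 : (n : ℝ) * (√β * w₀ / n) = √β * w₀ := by field_simp
  have h7 : (n : ℝ) * (β / (4 * n ^ 2)) ≤ β / 4 := by
    have : (n : ℝ) * (β / (4 * n ^ 2)) = β / 4 / n := by field_simp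
    rw [this]
    exact div_le_self (by positivity) hn1
  have h8 : 2 * ∑ i ∈ Finset.range n, w i ^ 2 ≤
      n * (fluxK (softplus a) (softplus u) / √β) + 2 * w₀ ^ 2 := by
    have hmul := mul_le_mul_of_nonneg_left hE (by positivity : 0 ≤ n / √β)
    have e1 : n / √β * (s * ∑ i ∈ Finset.range n, w i ^ 2) =
        2 * ∑ i ∈ Finset.range n, w i ^ 2 := by rw [hs]; field_simp
    have e2 : n / √β * (fluxK (softplus a) (softplus u) + s * w₀ * w₀) =
        n * (fluxK (softplus a) (softplus u) / √β) + 2 * w₀ ^ 2 := by rw [hs]; field_simp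
    rwa [e1, e2] at hmul
  rw [h6] at hsum
  have h0 : eulerPath (softplus a) u s 0 = u := rfl
  rw [h0, sub_self, mul_zero, add_zero, action]
  simp only [Finset.sum_sub_distrib]
  linarith

/-! ### Upper bound -/

lemma le_fluxK {α ω : ℝ} (hω : 0 < ω) (h : ω ≤ α) :
    2 / 3 * ((α - ω) * √(α - ω)) ≤ fluxK α ω := by
  have hα := hω.trans_le h
  have : (1 / 3 : ℝ) ≤ parAvg (fun t => t ^ 2) wt α ω := by
    have := intervalIntegral.integral_mono_on (μ := volume) (a := 0) (b := 1)
      (f := fun t => t ^ 2)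
      (g := fun t => t ^ 2 * wt (α * (1 - t ^ 2) + ω * t ^ 2)) zero_le_one
      (Continuous.intervalIntegrable (by fun_prop) _ _)
      (intervalIntegrable_parAvg continuousOn_wt (by fun_prop) hα hω) (fun t ht =>
        le_mul_of_one_le_right (sq_nonneg t)
          (one_lt_wt (hω.trans_le (parAvg_mem h le_rfl le_rfl h ht).1)).le)
    rw [integral_pow] at this
    norm_num at this
    simpa [parAvg] using this
  have h0 : 0 ≤ (α - ω) * √(α - ω) := mul_nonneg (sub_nonneg.2 h) (Real.sqrt_nonneg _)
  unfold fluxK abelHalf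
  nlinarith

lemma transfer_const_add_tsum (v : ℝ≥0) (c : ENNReal) {B : ℕ → ℝ → ENNReal}
    (hB : ∀ j, Measurable (B j)) (h : ℝ) :
    transfer v (fun x => c + ∑' j, B j x) h = transfer v (fun _ => c) h + ∑' j, transfer v (B j) h := by
  simp only [transfer]
  rw [lintegral_add_left measurable_const, mul_add, lintegral_tsum (fun j => by
    have := hB j
    fun_prop), ENNReal.tsum_mul_left]

/-- The weight, for `n` remaining steps, of the paths of maximal height between `softplus x`
and `α`. -/
noncomputable def barrier (κ α x : ℝ) (n : ℕ) (h : ℝ) : ENNReal :=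
  ENNReal.ofReal (Real.exp (n * α - κ * ∫ t in h..x, pathSpeed α t))

lemma measurable_barrier (κ α x : ℝ) (n : ℕ) : Measurable (barrier κ α x n) := by
  have : Continuous fun h => ∫ t in h..x, pathSpeed α t := by
    simp_rw [intervalIntegral.integral_symm x]
    exact (intervalIntegral.continuous_primitive (fun a b => intervalIntegrable_pathSpeed α a b) x).neg
  unfold barrier
  fun_prop

/-- The barrier is a supersolution. Its exponent is concave in `h` because the speed decreases, so
it lies below its tangent of slope `p = κ √(α - softplus h)`. For this slope `v p²/2 = α - softplus
h`, which completes the factor `1 + e^h = e^{softplus h}` to `e^α`; the drift contributes only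
`-vp/2 ≤ 0`. -/
lemma transfer_barrier_le {κ α x h : ℝ} {v : ℝ≥0} (hκ : 0 ≤ κ) (hv : v * κ ^ 2 = 2) (n : ℕ)
    (hh : softplus h ≤ α) : transfer v (barrier κ α x n) h ≤ barrier κ α x (n + 1) h := by
  set A := n * α - κ * ∫ t in h..x, pathSpeed α t with hA
  set p := κ * pathSpeed α h with hp
  have h1 : transfer v (barrier κ α x n) h ≤
      transfer v (fun y => ENNReal.ofReal (Real.exp (A + p * (y - h)))) h := by
    refine transfer_mono v fun z => ENNReal.ofReal_le_ofReal (Real.exp_le_exp.2 ?_)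
    have h2 := integral_pathSpeed_le α h (h + z)
    have h3 := intervalIntegral.integral_add_adjacent_intervals
      (intervalIntegrable_pathSpeed α h (h + z)) (intervalIntegrable_pathSpeed α (h + z) x)
    have h4 := mul_le_mul_of_nonneg_left h2 hκ
    rw [add_sub_cancel_left] at h4 ⊢
    rw [hA, hp, ← h3]
    linarith
  refine h1.trans ?_
  rw [transfer_exp]
  refine ENNReal.ofReal_le_ofReal (Real.exp_le_exp.2 ?_)
  have h5 : pathSpeed α h ^ 2 = α - softplus h := Real.sq_sqrt (sub_nonneg.2 hh)
  have h6 : (v : ℝ) * p ^ 2 = 2 * (α - softplus h) := by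
    rw [hp, mul_pow, ← mul_assoc, hv, h5]
  have h7 : 0 ≤ (v : ℝ) * p := mul_nonneg v.2 (mul_nonneg hκ (pathSpeed_nonneg _ _))
  push_cast
  linarith

/-- A path either stays below `a i` or has its maximum in some cell `[a j, a (j+1)]` with `j ≥ i`.
The starting index `i` is left free in the induction because below `a i` every term is a
supersolution, whereas above `a i` the bound with a larger index is used. -/
lemma iterate_transfer_le {κ ω δ : ℝ} {v : ℝ≥0} (hκ : 0 ≤ κ) (hv : v * κ ^ 2 = 2) (hδ : 0 < δ)
    {a : ℕ → ℝ} (ha : ∀ j : ℕ, softplus (a j) = ω + j * δ) (n i : ℕ) (h : ℝ) :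
    (transfer v)^[n] (fun _ => 1) h ≤ ENNReal.ofReal (Real.exp (n * (ω + i * δ))) +
      ∑' j, barrier κ (ω + ((i + j : ℕ) + 1) * δ) (a (i + j)) n h := by
  induction n generalizing i h with
  | zero =>
    refine le_trans ?_ le_self_add
    simp
  | succ n ih =>
    have hlow : ∀ i h, h ≤ a i → (transfer v)^[n + 1] (fun _ => 1) h ≤
        ENNReal.ofReal (Real.exp ((n + 1 : ℕ) * (ω + i * δ))) +
          ∑' j, barrier κ (ω + ((i + j : ℕ) + 1) * δ) (a (i + j)) (n + 1) h := by
      intro i h hh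
      have hsp : softplus h ≤ ω + i * δ := ha i ▸ strictMono_softplus.monotone hh
      rw [Function.iterate_succ_apply']
      refine (transfer_mono v (g₂ := fun x => ENNReal.ofReal (Real.exp (n * (ω + i * δ))) +
        ∑' j, barrier κ (ω + ((i + j : ℕ) + 1) * δ) (a (i + j)) n x) fun z => ih i (h + z)).trans ?_
      rw [transfer_const_add_tsum v _ (fun j => measurable_barrier _ _ _ _), transfer_const]
      refine add_le_add (ENNReal.ofReal_le_ofReal (Real.exp_le_exp.2 ?_))
        (ENNReal.tsum_le_tsum fun j => transfer_barrier_le hκ hv n (hsp.trans ?_))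
      · push_cast
        linarith
      · push_cast
        nlinarith [(Nat.cast_nonneg j : (0 : ℝ) ≤ j)]
    by_cases hh : h ≤ a i
    · exact hlow i h hh
    have hex : ∃ j, h ≤ a j := by
      obtain ⟨j, hj⟩ := exists_nat_gt ((softplus h - ω) / δ)
      refine ⟨j, strictMono_softplus.le_iff_le.1 ?_⟩
      rw [ha]
      rw [div_lt_iff₀ hδ] at hj
      linarith
    have hamono : Monotone a := fun j k hjk => strictMono_softplus.le_iff_le.1 (by
      rw [ha, ha]
      have : (j : ℝ) ≤ k := Nat.cast_le.2 hjk
      nlinarith)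
    classical
    have hfind := Nat.find_spec hex
    set k := Nat.find hex with hk
    have hik : i < k := by
      by_contra! hle
      exact hh (hfind.trans (hamono hle))
    obtain ⟨m, hm⟩ : ∃ m, k = m + 1 := ⟨k - 1, by omega⟩
    have hmh : a m < h := not_le.1 (Nat.find_min hex (show m < Nat.find hex by omega))
    refine (hlow k h hfind).trans ?_
    -- Above `a m` the integral in the barrier is nonpositive, so the barrier with index `m = k - 1`
    -- absorbs the constant term of the bound with index `k`. The remaining barriers, of index at
    -- least `k`, already occur in the sum.
    have hfirst : ENNReal.ofReal (Real.exp ((n + 1 : ℕ) * (ω + k * δ))) ≤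
        barrier κ (ω + ((m : ℕ) + 1) * δ) (a m) (n + 1) h := by
      refine ENNReal.ofReal_le_ofReal (Real.exp_le_exp.2 ?_)
      have h1 : ∫ t in h..a m, pathSpeed (ω + ((m : ℕ) + 1) * δ) t ≤ 0 := by
        rw [intervalIntegral.integral_symm, neg_nonpos]
        exact intervalIntegral.integral_nonneg hmh.le fun t _ => pathSpeed_nonneg _ _
      have h2 := mul_nonneg hκ (neg_nonneg.2 h1)
      rw [hm]
      push_cast
      linarith
    refine (add_le_add_left hfirst _).trans ((le_add_left ?_ : _ ≤ _ + _))
    obtain ⟨d, hd⟩ : ∃ d, m = i + d := ⟨m - i, by omega⟩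
    have hsplit := ENNReal.tsum_comp_le_tsum_of_injective (add_right_injective d)
      (fun j => barrier κ (ω + ((i + j : ℕ) + 1) * δ) (a (i + j)) (n + 1) h)
    refine le_trans (le_of_eq ?_) hsplit
    conv_rhs => rw [tsum_eq_zero_add' ENNReal.summable]
    congr 1
    · simp [hd]
    · refine tsum_congr fun j => ?_
      rw [hm, hd, show i + (d + (j + 1)) = i + d + 1 + j by omega]

/-- A linear minorant of `x^{3/2}` with arbitrary slope. Below, `R` is tuned so that the `j`-th
exponent decreases with slope `-1` in `j`. -/
lemma mul_sqrt_ge {x : ℝ} (hx : 0 ≤ x) {R : ℝ} (hR : 0 ≤ R) : R * x - R ^ 3 ≤ x * √x := by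
  have hs := Real.sqrt_nonneg x
  rcases le_total R (√x) with h | h
  · have := mul_le_mul_of_nonneg_left h hx
    have : 0 ≤ R ^ 3 := by positivity
    linarith
  · have h1 : x ≤ R ^ 2 := by
      rw [← Real.sq_sqrt hx]
      gcongr
    have := mul_le_mul_of_nonneg_left h1 hR
    have := mul_nonneg hx hs
    nlinarith

/-- At the starting point the `j`-th barrier is at most `exp (n (action + δ))`, the action being
taken at height `ω + jδ`; the loss `δ` is the width of a cell. The superlinear growth of `fluxK` in
the height makes the sum over `j` converge. -/
lemma iterate_transfer_le_exp {β u S δ : ℝ} (hβ : 0 < β)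
    (hS : ∀ α, softplus u ≤ α → action α (softplus u) β ≤ S) (hδ : 0 < δ) :
    ∃ C : ℝ, 0 < C ∧ ∀ (n : ℕ) (v : ℝ≥0), 0 < n → (v : ℝ) = 2 * β / n ^ 2 →
      (transfer v)^[n] (fun _ => 1) u ≤ ENNReal.ofReal (C * Real.exp (n * (S + δ))) := by
  set ω := softplus u with hω
  have hω0 : 0 < ω := softplus_pos u
  have hβsq : √β ^ 2 = β := Real.sq_sqrt hβ.le
  choose a ha using fun j : ℕ => exists_softplus_eq (y := ω + j * δ) (by positivity)
  -- a linear bound for the action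
  set R := 3 * √β * (δ + 1) / (2 * δ) with hR
  have hR0 : 0 ≤ R := by positivity
  set D := ω + δ + 2 / (3 * √β) * R ^ 3 with hD
  have hlin : ∀ j : ℕ, ω + (j + 1) * δ - fluxK (ω + j * δ) ω / √β ≤ D - j := by
    intro j
    have hj : (0 : ℝ) ≤ j * δ := by positivity
    have h1 := le_fluxK hω0 (by linarith : ω ≤ ω + j * δ)
    rw [add_sub_cancel_left] at h1
    have h2 := mul_sqrt_ge hj hR0
    have h3 : 2 / 3 * (R * (j * δ) - R ^ 3) / √β ≤ fluxK (ω + j * δ) ω / √β := by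
      gcongr
      linarith
    have h4 : 2 / 3 * (R * (j * δ) - R ^ 3) / √β = (δ + 1) * j - 2 / (3 * √β) * R ^ 3 := by
      have : R * (j * δ) = 3 * √β * (δ + 1) * j / 2 := by rw [hR]; field_simp
      rw [this]
      field_simp
    rw [h4] at h3
    rw [hD]
    linarith
  have hact : ∀ j : ℕ, ω + (j + 1) * δ - fluxK (ω + j * δ) ω / √β ≤ S + δ := by
    intro j
    have := hS (ω + j * δ) (by simp; positivity)
    rw [action] at this
    linarith
  have hgeo : Summable fun j : ℕ => Real.exp (-(j : ℝ)) := by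
    simpa [Real.exp_neg] using Real.summable_exp_neg_nat
  set G := ∑' j : ℕ, Real.exp (-(j : ℝ)) with hG
  refine ⟨1 + Real.exp (D - (S + δ)) * G, by positivity, fun n v hn hv => ?_⟩
  have hn' : (0 : ℝ) < n := Nat.cast_pos.2 hn
  have hn1 : (1 : ℝ) ≤ n := Nat.one_le_cast.2 hn
  have hκ : (v : ℝ) * ((n : ℝ) / √β) ^ 2 = 2 := by
    rw [hv, div_pow, hβsq]
    field_simp
  refine (iterate_transfer_le (by positivity) hκ hδ ha n 0 u).trans ?_
  have hω' : ω ≤ S + δ := by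
    have := hS ω le_rfl
    rw [action, fluxK_self, zero_div] at this
    linarith
  have hbar : ∀ j : ℕ, barrier (n / √β) (ω + ((0 + j : ℕ) + 1) * δ) (a (0 + j)) n u ≤
      ENNReal.ofReal (Real.exp (n * (S + δ)) * (Real.exp (D - (S + δ)) * Real.exp (-(j : ℝ)))) := by
    intro j
    rw [← Real.exp_add, ← Real.exp_add, zero_add]
    refine ENNReal.ofReal_le_ofReal (Real.exp_le_exp.2 ?_)
    have huj : u ≤ a j := strictMono_softplus.le_iff_le.1 (by
      have : (0 : ℝ) ≤ j * δ := by positivity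
      rw [ha]
      linarith)
    have h1 : fluxK (ω + j * δ) ω ≤ ∫ t in u..a j, pathSpeed (ω + (j + 1) * δ) t := by
      have := integral_sqrt_softplus huj
      rw [ha] at this
      rw [← this]
      refine intervalIntegral.integral_mono_on huj (intervalIntegrable_pathSpeed (ω + j * δ) _ _)
        (intervalIntegrable_pathSpeed _ _ _) fun t _ => Real.sqrt_le_sqrt ?_
      linarith
    have h2 : n * (ω + (j + 1) * δ) - n / √β * ∫ t in u..a j, pathSpeed (ω + (j + 1) * δ) t ≤
        n * (ω + (j + 1) * δ - fluxK (ω + j * δ) ω / √β) := by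
      have := mul_le_mul_of_nonneg_left h1 (by positivity : 0 ≤ n / √β)
      have e : n / √β * fluxK (ω + j * δ) ω = n * (fluxK (ω + j * δ) ω / √β) := by ring
      linarith
    refine h2.trans ?_
    -- With `n = (n - 1) + 1`, the uniform bound `S + δ` serves `n - 1` times and the summable bound
    -- `D - j` once, so the constant does not depend on `n`.
    have h3 := mul_le_mul_of_nonneg_left (hact j) (sub_nonneg.2 hn1)
    have h4 := hlin j
    linarith
  refine (add_le_add (ENNReal.ofReal_le_ofReal (Real.exp_le_exp.2 ?_ : _ ≤ Real.exp (n * (S + δ))))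
    (ENNReal.tsum_le_tsum hbar)).trans (le_of_eq ?_)
  · simp only [Nat.cast_zero, zero_mul, add_zero]
    gcongr
  · rw [← ENNReal.ofReal_tsum_of_nonneg (fun _ => by positivity)
      ((hgeo.mul_left _).mul_left _), tsum_mul_left, tsum_mul_left, ← hG,
      ← ENNReal.ofReal_add (Real.exp_pos _).le (by positivity)]
    congr 1
    ring

/-! ### From Brownian motion to the transfer operator -/

lemma multProcess_congr {Ω Ω' : Type*} {W : ℝ≥0 → Ω → ℝ} {W' : ℝ≥0 → Ω' → ℝ} {x₀ : ℝ} {τ : ℝ≥0}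
    {ρ σ : ℝ} {n : ℕ} {ω : Ω} {ω' : Ω'} (h : ∀ i < n, W (i * τ) ω = W' (i * τ) ω') :
    multProcess W x₀ τ ρ σ n ω = multProcess W' x₀ τ ρ σ n ω' := by
  induction n with
  | zero => rfl
  | succ n ih =>
    simp only [multProcess]
    rw [ih fun i hi => h i (hi.trans n.lt_succ_self), h n n.lt_succ_self]

lemma measurable_multProcess {Ω : Type*} [MeasurableSpace Ω] {W : ℝ≥0 → Ω → ℝ}
    (hW : ∀ t, Measurable (W t)) (x₀ : ℝ) (τ : ℝ≥0) (ρ σ : ℝ) (n : ℕ) :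
    Measurable (multProcess W x₀ τ ρ σ n) := by
  induction n with
  | zero => exact measurable_const
  | succ n ih =>
    have := hW (n * τ)
    unfold multProcess
    fun_prop

lemma aemeasurable_multProcess {Ω : Type*} [MeasurableSpace Ω] {P : Measure Ω} {W : ℝ≥0 → Ω → ℝ}
    (hW : ∀ t, AEMeasurable (W t) P) (x₀ : ℝ) (τ : ℝ≥0) (ρ σ : ℝ) (n : ℕ) :
    AEMeasurable (multProcess W x₀ τ ρ σ n) P := by
  induction n with
  | zero => exact aemeasurable_const
  | succ n ih =>
    have := hW (n * τ)
    unfold multProcess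
    fun_prop

lemma multProcess_pos {Ω : Type*} (W : ℝ≥0 → Ω → ℝ) {x₀ : ℝ} (hx₀ : 0 < x₀) (τ : ℝ≥0) {ρ : ℝ}
    (hρ : 0 < ρ) (σ : ℝ) (n : ℕ) (ω : Ω) : 0 < multProcess W x₀ τ ρ σ n ω := by
  induction n with
  | zero => exact hx₀
  | succ n ih =>
    simp only [multProcess]
    positivity

/-- The test function `g` of the current logarithmic position makes the induction close:
conditioning on the past up to time `nτ` replaces `g` by `transfer v g`. -/
lemma lintegral_multProcess {Ω : Type*} [MeasurableSpace Ω] {P : Measure Ω} {W : ℝ≥0 → Ω → ℝ}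
    (hW : IsPreBrownianReal W P) (x₀ : ℝ) {τ v : ℝ≥0} {ρ σ : ℝ} (hρ : 0 < ρ)
    (hv : (v : ℝ) = σ ^ 2 * τ) (n : ℕ) {g : ℝ → ENNReal} (hg : Measurable g) :
    ∫⁻ ω, ENNReal.ofReal (multProcess W x₀ τ ρ σ n ω) *
      g (Real.log ρ + (σ * W (n * τ) ω - σ ^ 2 * (n * τ) / 2)) ∂P =
      ENNReal.ofReal x₀ * (transfer v)^[n] g (Real.log ρ) := by
  have hP : IsProbabilityMeasure P := hW.isGaussianProcess.isProbabilityMeasure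
  induction n generalizing g with
  | zero =>
    have : ∀ᵐ ω ∂P, ENNReal.ofReal (multProcess W x₀ τ ρ σ 0 ω) *
        g (Real.log ρ + (σ * W ((0 : ℕ) * τ) ω - σ ^ 2 * ((0 : ℕ) * τ) / 2)) =
        ENNReal.ofReal x₀ * g (Real.log ρ) := by
      filter_upwards [hW.eval_zero_ae_eq_zero] with ω hω
      simp [multProcess, hω]
    rw [lintegral_congr_ae this]
    simp
  | succ n ih =>
    set t₀ : ℝ≥0 := n * τ with ht₀
    -- The process up to step `n` is rewritten as a function of the path on `[0, t₀]` alone, to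
    -- which independence of the shifted increments applies. The value `0` beyond `t₀` is never
    -- read.
    let e : ℝ≥0 → (Set.Iic t₀ → ℝ) → ℝ := fun t f => if h : t ≤ t₀ then f ⟨t, h⟩ else 0
    have he : ∀ t, Measurable (e t) := by
      intro t
      by_cases h : t ≤ t₀
      · simpa [e, h] using measurable_pi_apply (X := fun _ : Set.Iic t₀ => ℝ) ⟨t, h⟩
      · simp [e, h]
    have hY : ∀ ω, multProcess W x₀ τ ρ σ n ω =
        multProcess e x₀ τ ρ σ n (fun t : Set.Iic t₀ => W t ω) := by
      intro ω
      refine multProcess_congr fun i hi => ?_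
      have : (i : ℝ≥0) * τ ≤ t₀ := by rw [ht₀]; gcongr
      simp [e, this]
    have hYm : Measurable fun f : Set.Iic t₀ → ℝ => (multProcess e x₀ τ ρ σ n f, f ⟨t₀, Set.mem_Iic.2 le_rfl⟩) :=
      (measurable_multProcess he x₀ τ ρ σ n).prodMk
        (measurable_pi_apply (X := fun _ : Set.Iic t₀ => ℝ) (⟨t₀, Set.mem_Iic.2 le_rfl⟩ : Set.Iic t₀))
    have hindep := (hW.indepFun_shift t₀).symm.comp hYm (measurable_pi_apply (X := fun _ : ℝ≥0 => ℝ) τ)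
    set Y : Ω → ℝ × ℝ := fun ω => (multProcess W x₀ τ ρ σ n ω, W t₀ ω) with hYdef
    set D : Ω → ℝ := fun ω => W (t₀ + τ) ω - W t₀ ω with hD
    have hindep' : IndepFun Y D P := by
      convert! hindep using 1
      ext ω
      · exact hY ω
      · rfl
    have hYae : AEMeasurable Y P :=
      (aemeasurable_multProcess hW.aemeasurable x₀ τ ρ σ n).prodMk (hW.aemeasurable _)
    have hDae : AEMeasurable D P := (hW.aemeasurable _).sub (hW.aemeasurable _)
    have hDlaw : P.map D = gaussianReal 0 τ := by
      have := (hW.hasLaw_sub (t₀ + τ) t₀).map_eq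
      have hd : nndist ((t₀ + τ : ℝ≥0) : ℝ) (t₀ : ℝ) = τ := by
        ext
        simp
      change P.map D = gaussianReal 0 (nndist ((t₀ + τ : ℝ≥0) : ℝ) (t₀ : ℝ)) at this
      rwa [hd] at this
    have hstep : (gaussianReal 0 τ).map (fun d => σ * d + -(v : ℝ) / 2) =
        gaussianReal (-v / 2) v := by
      have h1 : (gaussianReal 0 τ).map (fun d => σ * d) = gaussianReal 0 v := by
        rw [gaussianReal_map_const_mul, mul_zero]
        congr 1
        ext
        simp [hv]
      have h2 := gaussianReal_map_add_const (μ := 0) (v := v) (-(v : ℝ) / 2)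
      rw [← h1, Measure.map_map (by fun_prop) (by fun_prop), zero_add] at h2
      exact h2
    let Φ : (ℝ × ℝ) × ℝ → ENNReal := fun q =>
      ENNReal.ofReal q.1.1 *
        (ENNReal.ofReal (1 + Real.exp (Real.log ρ + (σ * q.1.2 - σ ^ 2 * (n * τ) / 2))) *
          g (Real.log ρ + (σ * q.1.2 - σ ^ 2 * (n * τ) / 2) + (σ * q.2 + -(v : ℝ) / 2)))
    have hΦ : Measurable Φ := by fun_prop
    have hint : ∀ ω, ENNReal.ofReal (multProcess W x₀ τ ρ σ (n + 1) ω) *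
        g (Real.log ρ + (σ * W ((n + 1 : ℕ) * τ) ω - σ ^ 2 * ((n + 1 : ℕ) * τ) / 2)) =
        Φ (Y ω, D ω) := by
      intro ω
      simp only [Φ, hYdef, hD, multProcess]
      have h1 : ((n + 1 : ℕ) : ℝ≥0) * τ = t₀ + τ := by rw [ht₀]; push_cast; ring
      have h2 : Real.log ρ + (σ * W (t₀ + τ) ω - σ ^ 2 * ((n + 1 : ℕ) * τ) / 2) =
          Real.log ρ + (σ * W t₀ ω - σ ^ 2 * (n * τ) / 2) +
            (σ * (W (t₀ + τ) ω - W t₀ ω) + -(v : ℝ) / 2) := by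
        rw [hv]
        push_cast
        ring
      rw [ENNReal.ofReal_mul (by positivity), Real.exp_add, Real.exp_log hρ, h1, h2]
      ring
    simp_rw [hint]
    rw [← lintegral_map' hΦ.aemeasurable (hYae.prodMk hDae),
      (indepFun_iff_map_prod_eq_prod_map_map hYae hDae).1 hindep', hDlaw,
      lintegral_prod _ hΦ.aemeasurable, lintegral_map' hΦ.lintegral_prod_right'.aemeasurable hYae,
      Function.iterate_succ_apply, ← ih (measurable_transfer v hg)]
    refine lintegral_congr fun ω => ?_
    simp only [Φ, hYdef]
    rw [lintegral_const_mul _ (by fun_prop), lintegral_const_mul _ (by fun_prop), transfer,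
      ← hstep, lintegral_map (by fun_prop) (by fun_prop)]

lemma integral_multProcess {Ω : Type*} [MeasurableSpace Ω] {P : Measure Ω} {W : ℝ≥0 → Ω → ℝ}
    (hW : IsPreBrownianReal W P) {x₀ : ℝ} (hx₀ : 0 < x₀) {τ v : ℝ≥0} {ρ σ : ℝ} (hρ : 0 < ρ)
    (hv : (v : ℝ) = σ ^ 2 * τ) (n : ℕ) :
    ∫ ω, multProcess W x₀ τ ρ σ n ω ∂P =
      x₀ * ((transfer v)^[n] (fun _ => 1) (Real.log ρ)).toReal := by
  have h := lintegral_multProcess hW x₀ hρ hv n (g := fun _ => 1) measurable_const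
  simp only [mul_one] at h
  rw [integral_eq_lintegral_of_nonneg_ae
    (Eventually.of_forall fun ω => (multProcess_pos W hx₀ τ hρ σ n ω).le)
    (aemeasurable_multProcess hW.aemeasurable x₀ τ ρ σ n).aestronglyMeasurable, h,
    ENNReal.toReal_mul, ENNReal.toReal_ofReal hx₀.le]

/-- The growth rate converges to the maximum of the action. -/
lemma tendsto_growthRate {Ω : Type*} [MeasurableSpace Ω] {P : Measure Ω} {W : ℝ≥0 → Ω → ℝ}
    (hW : IsPreBrownianReal W P) {x₀ : ℝ} (hx₀ : 0 < x₀) {τ : ℕ → ℝ≥0} (hτ : ∀ n, 0 < τ n)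
    {ρ β α : ℝ} (hρ : 0 < ρ) (hβ : 0 < β) (hα : Real.log (1 + ρ) ≤ α)
    (hmax : ∀ α', Real.log (1 + ρ) ≤ α' →
      action α' (Real.log (1 + ρ)) β ≤ action α (Real.log (1 + ρ)) β) :
    Tendsto (growthRate P W x₀ τ ρ β) atTop (𝓝 (action α (Real.log (1 + ρ)) β)) := by
  rw [← softplus_log hρ] at hα hmax ⊢
  set u := Real.log ρ
  set S := action α (softplus u) β
  obtain ⟨C, hC⟩ := exp_le_iterate_transfer hβ hα
  have hrate : ∀ n : ℕ, 0 < n → ∃ v : ℝ≥0, (v : ℝ) = 2 * β / n ^ 2 ∧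
      growthRate P W x₀ τ ρ β n =
        1 / n * Real.log (x₀ * ((transfer v)^[n] (fun _ => 1) u).toReal) := by
    intro n hn
    have hn' : (0 : ℝ) < n := Nat.cast_pos.2 hn
    have hτn : (0 : ℝ) < τ n := hτ n
    refine ⟨⟨2 * β / n ^ 2, by positivity⟩, rfl, ?_⟩
    rw [growthRate, integral_multProcess (v := ⟨2 * β / n ^ 2, by positivity⟩) hW hx₀ hρ]
    change 2 * β / (n : ℝ) ^ 2 = _
    rw [div_pow, Real.sq_sqrt (by positivity)]
    field_simp
  have hfin : ∀ δ : ℝ, 0 < δ → ∃ C' : ℝ, ∀ n : ℕ, 0 < n →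
      S - (C - Real.log x₀) / n ≤ growthRate P W x₀ τ ρ β n ∧
      growthRate P W x₀ τ ρ β n ≤ S + δ + C' / n := by
    intro δ hδ
    obtain ⟨C', hC'0, hC'⟩ := iterate_transfer_le_exp hβ hmax hδ
    refine ⟨Real.log x₀ + Real.log C', fun n hn => ?_⟩
    have hn' : (0 : ℝ) < n := Nat.cast_pos.2 hn
    obtain ⟨v, hv, hgr⟩ := hrate n hn
    have hup := hC' n v hn hv
    have hlo := hC n v hn hv
    have hne : (transfer v)^[n] (fun _ => 1) u ≠ ⊤ := ne_top_of_le_ne_top ENNReal.ofReal_ne_top hup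
    have hup' := ENNReal.toReal_le_of_le_ofReal (by positivity) hup
    have hlo' := (ENNReal.ofReal_le_iff_le_toReal hne).1 hlo
    have hpos := (Real.exp_pos _).trans_le hlo'
    rw [hgr, Real.log_mul hx₀.ne' hpos.ne']
    have h1 := (Real.le_log_iff_exp_le hpos).2 hlo'
    have h2 := Real.log_le_log hpos hup'
    rw [Real.log_mul hC'0.ne' (Real.exp_pos _).ne', Real.log_exp] at h2
    constructor
    · have : S - (C - Real.log x₀) / n = 1 / n * (Real.log x₀ + (n * S - C)) := by
        field_simp; ring
      rw [this]
      gcongr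
    · have : S + δ + (Real.log x₀ + Real.log C') / n =
          1 / n * (Real.log x₀ + (Real.log C' + n * (S + δ))) := by
        field_simp; ring
      rw [this]
      gcongr
  have hdiv : ∀ c : ℝ, Tendsto (fun n : ℕ => c / n) atTop (𝓝 0) := fun c =>
    tendsto_const_div_atTop_nhds_zero_nat c
  rw [tendsto_order]
  constructor
  · intro y hy
    obtain ⟨C', h⟩ := hfin 1 one_pos
    have h1 : ∀ᶠ n : ℕ in atTop, (C - Real.log x₀) / n < S - y :=
      (hdiv _).eventually (gt_mem_nhds (by linarith))
    filter_upwards [h1, eventually_gt_atTop 0] with n hn hn0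
    linarith [(h n hn0).1]
  · intro y hy
    obtain ⟨C', h⟩ := hfin ((y - S) / 2) (by linarith)
    have h1 : ∀ᶠ n : ℕ in atTop, C' / n < (y - S) / 2 :=
      (hdiv _).eventually (gt_mem_nhds (by linarith))
    filter_upwards [h1, eventually_gt_atTop 0] with n hn hn0
    linarith [(h n hn0).2]

/-! ### Maximizers of the action -/

lemma strictAntiOn_fluxF (α : ℝ) : StrictAntiOn (fun ω => fluxF α ω) (Set.Ioo 0 α) := by
  refine strictAntiOn_of_deriv_neg (convex_Ioo 0 α) (fun ω hω =>
    (hasDerivAt_fluxF_right hω.1 hω.2).continuousAt.continuousWithinAt) fun ω hω => ?_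
  rw [interior_Ioo] at hω
  rw [(hasDerivAt_fluxF_right hω.1 hω.2).deriv]
  exact div_neg_of_neg_of_pos (neg_neg_of_pos (wt_pos hω.1)) (Real.sqrt_pos.2 (sub_pos.2 hω.2))

lemma continuousAt_fluxF {p : ℝ × ℝ} (h₁ : 0 < p.1) (h₂ : 0 < p.2) :
    ContinuousAt (fun p : ℝ × ℝ => fluxF p.1 p.2) p :=
  ContinuousAt.mul (by fun_prop)
    (analyticAt_parAvg_wt (m := ⟨fun _ => 1, by fun_prop⟩) h₁ h₂).continuousAt

lemma hasDerivAt_action {α ω β : ℝ} (hω : 0 < ω) (h : ω < α) :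
    HasDerivAt (fun α => action α ω β) (1 - fluxF α ω / 2 / √β) α :=
  (hasDerivAt_id α).sub ((hasDerivAt_fluxK_left hω h).div_const _)

lemma continuousAt_action {α ω β : ℝ} (hα : 0 < α) (hω : 0 < ω) :
    ContinuousAt (fun α => action α ω β) α :=
  continuousAt_id.sub ((continuousAt_fluxK_left hα hω).div_const _)

/-- `α` is an interior maximizer of the action at the point `p = (ρ, β)`. -/
structure IsMaximizer (α : ℝ) (p : ℝ × ℝ) : Prop where
  lt : Real.log (1 + p.1) < α
  fluxF_eq : fluxF α (Real.log (1 + p.1)) = 2 * √p.2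
  le_action : ∀ α', Real.log (1 + p.1) ≤ α' →
    action α' (Real.log (1 + p.1)) p.2 ≤ action α (Real.log (1 + p.1)) p.2

/-- The action increases just above `ω`, where `F` is close to `0`, and does not increase beyond `ω
+ β`, where `F ≥ 2√β`. A maximum on the compact interval is thus global and interior. -/
lemma exists_isMaximizer {p : ℝ × ℝ} (hp : p ∈ paramSpace) : ∃ α, IsMaximizer α p := by
  obtain ⟨hρ, hβ⟩ := hp
  have hω := log_one_add_pos hρ
  set ω := Real.log (1 + p.1) with hωdef
  have hsβ : 0 < √p.2 := Real.sqrt_pos.2 hβ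
  have hcont : ContinuousOn (fun α => action α ω p.2) (Set.Ici ω) := fun α hα =>
    (continuousAt_action (lt_of_lt_of_le hω hα) hω).continuousWithinAt
  obtain ⟨α, hα, hmax⟩ := (isCompact_Icc (a := ω) (b := ω + p.2)).exists_isMaxOn
    (Set.nonempty_Icc.2 (by linarith)) (hcont.mono Set.Icc_subset_Ici_self)
  have hglob : ∀ α', ω ≤ α' → action α' ω p.2 ≤ action α ω p.2 := by
    intro α' hα'
    rcases le_total α' (ω + p.2) with h | h
    · exact hmax ⟨hα', h⟩
    · refine le_trans ?_ (hmax (Set.right_mem_Icc.2 (by linarith : ω ≤ ω + p.2)))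
      have hanti : AntitoneOn (fun α => action α ω p.2) (Set.Ici (ω + p.2)) := by
        have hd : ∀ x ∈ Set.Ioi (ω + p.2), HasDerivAt (fun α => action α ω p.2)
            (1 - fluxF x ω / 2 / √p.2) x := fun x hx =>
          hasDerivAt_action hω (by have : ω + p.2 < x := hx; linarith)
        refine antitoneOn_of_deriv_nonpos (convex_Ici _)
          (hcont.mono (Set.Ici_subset_Ici.2 (by linarith))) ?_ ?_
        · rw [interior_Ici]
          exact fun x hx => (hd x hx).differentiableAt.differentiableWithinAt
        · rw [interior_Ici]
          intro x hx
          rw [(hd x hx).deriv]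
          have hx' : ω + p.2 < x := hx
          have h1 := two_sqrt_le_fluxF hω (by linarith : ω ≤ x)
          have h2 : √p.2 ≤ √(x - ω) := Real.sqrt_le_sqrt (by linarith)
          have h3 : 1 ≤ fluxF x ω / 2 / √p.2 := by
            rw [le_div_iff₀ hsβ]
            linarith
          linarith
      exact hanti (Set.self_mem_Ici) h h
  have hlt : ω < α := by
    refine lt_of_le_of_ne hα.1 fun heq => ?_
    have hF : ∀ᶠ x in 𝓝 ω, fluxF x ω < 2 * √p.2 := by
      have hc : ContinuousAt (fun x => fluxF x ω) ω :=
        (continuousAt_fluxF (p := (ω, ω)) hω hω).comp (f := fun x => (x, ω)) (by fun_prop)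
      refine hc.eventually (gt_mem_nhds ?_)
      simp only [fluxF_self]
      positivity
    obtain ⟨η, hη, hball⟩ := Metric.eventually_nhds_iff.1 hF
    have hmono : StrictMonoOn (fun α => action α ω p.2) (Set.Icc ω (ω + η)) := by
      refine strictMonoOn_of_deriv_pos (convex_Icc _ _) (hcont.mono Set.Icc_subset_Ici_self)
        fun x hx => ?_
      rw [interior_Icc] at hx
      rw [(hasDerivAt_action hω hx.1).deriv, sub_pos, div_lt_one hsβ]
      have := hball (y := x) (by rw [Real.dist_eq, abs_lt]; constructor <;> linarith [hx.1, hx.2])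
      linarith
    have h1 := hmono (Set.left_mem_Icc.2 (by linarith)) (Set.right_mem_Icc.2 (by linarith))
      (by linarith : ω < ω + η)
    have h2 := hglob (ω + η) (by linarith)
    rw [← heq] at h2
    exact absurd h2 (not_le.2 h1)
  refine ⟨α, hlt, ?_, hglob⟩
  have hloc : IsLocalMax (fun α => action α ω p.2) α := by
    filter_upwards [lt_mem_nhds hlt] with x hx
    exact hglob x hx.le
  have := hloc.hasDerivAt_eq_zero (hasDerivAt_action hω hlt)
  field_simp at this
  linarith

/-- Monotone comparative statics: the maximizers increase with the parameters. -/
lemma IsMaximizer.le {α α' : ℝ} {p q : ℝ × ℝ} (hp : p ∈ paramSpace) (hq : q ∈ paramSpace)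
    (h : IsMaximizer α p) (h' : IsMaximizer α' q) (h₁ : p.1 ≤ q.1) (h₂ : p.2 ≤ q.2)
    (hne : p ≠ q) : α ≤ α' := by
  by_contra! hlt
  have hωp := log_one_add_pos hp.1
  have hωq := log_one_add_pos hq.1
  have hω : Real.log (1 + p.1) ≤ Real.log (1 + q.1) :=
    Real.log_le_log (by linarith [hp.1]) (by linarith)
  -- Since `F` decreases in `ω` and is divided by `√β`, raising the parameters raises the slope of
  -- the action. If `α' < α`, this contradicts the sum of the two optimality inequalities.
  have hmono : StrictMonoOn (fun x => action x (Real.log (1 + q.1)) q.2 -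
      action x (Real.log (1 + p.1)) p.2) (Set.Ioi (Real.log (1 + q.1))) := by
    have hd : ∀ x ∈ Set.Ioi (Real.log (1 + q.1)), HasDerivAt
        (fun x => action x (Real.log (1 + q.1)) q.2 - action x (Real.log (1 + p.1)) p.2)
        ((1 - fluxF x (Real.log (1 + q.1)) / 2 / √q.2) -
          (1 - fluxF x (Real.log (1 + p.1)) / 2 / √p.2)) x := fun x hx =>
      (hasDerivAt_action hωq hx).sub (hasDerivAt_action hωp (lt_of_le_of_lt hω hx))
    refine strictMonoOn_of_deriv_pos (convex_Ioi _)
      (fun x hx => (hd x hx).continuousAt.continuousWithinAt) fun x hx => ?_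
    rw [interior_Ioi] at hx
    rw [(hd x hx).deriv]
    have hFq := fluxF_pos hωq hx
    have hsp : 0 < √p.2 := Real.sqrt_pos.2 hp.2
    have hlt : fluxF x (Real.log (1 + q.1)) / 2 / √q.2 <
        fluxF x (Real.log (1 + p.1)) / 2 / √p.2 := by
      rcases h₁.eq_or_lt with he | hl
      · have hβ : p.2 < q.2 := lt_of_le_of_ne h₂ fun h => hne (Prod.ext he h)
        have hs' : √p.2 < √q.2 := Real.sqrt_lt_sqrt hp.2.le hβ
        rw [he]
        gcongr
      · have hF := strictAntiOn_fluxF x ⟨hωp, lt_of_le_of_lt hω hx⟩ ⟨hωq, hx⟩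
          (log_one_add_lt hp.1 hl)
        simp only at hF
        calc _ ≤ fluxF x (Real.log (1 + q.1)) / 2 / √p.2 := by gcongr
          _ < _ := by gcongr
    linarith
  have h3 := hmono h'.lt (h'.lt.trans hlt) hlt
  have h4 := h.le_action α' (hω.trans h'.lt.le)
  have h5 := h'.le_action α (h'.lt.trans hlt).le
  simp only at h3
  linarith

lemma IsMaximizer.unique {α α' : ℝ} {p : ℝ × ℝ} (hp : rhoC ≤ p.1) (h : IsMaximizer α p)
    (hα' : Real.log (1 + p.1) < α') (hF : fluxF α' (Real.log (1 + p.1)) = 2 * √p.2) : α' = α :=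
  (strictMonoOn_fluxF (Real.log_le_log (by linarith [rhoC_pos]) (by linarith))).injOn hα' h.lt
    (hF.trans h.fluxF_eq.symm)

lemma isOpen_paramSpace : IsOpen paramSpace :=
  (isOpen_lt continuous_const continuous_fst).inter (isOpen_lt continuous_const continuous_snd)

lemma continuousAt_log_one_add {ρ : ℝ} (hρ : 0 < ρ) : ContinuousAt (fun ρ => Real.log (1 + ρ)) ρ :=
  (Real.continuousAt_log (by linarith)).comp (f := fun ρ : ℝ => 1 + ρ) (by fun_prop)

/-- Near a point with a unique solution of the flux equation all maximizers are close to it. -/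
lemma eventually_isMaximizer_mem {α₀ : ℝ} {p₀ : ℝ × ℝ} (hp₀ : p₀ ∈ paramSpace)
    (huniq : ∀ α, Real.log (1 + p₀.1) < α → fluxF α (Real.log (1 + p₀.1)) = 2 * √p₀.2 → α = α₀)
    {N : Set (ℝ × ℝ × ℝ)} (hN : N ∈ 𝓝 (α₀, p₀)) :
    ∀ᶠ p in 𝓝 p₀, p ∈ paramSpace ∧ ∀ α, IsMaximizer α p → (α, p) ∈ N := by
  refine (isOpen_paramSpace.eventually_mem hp₀).and ?_
  by_contra hcon
  obtain ⟨p, hlim, hp⟩ := exists_seq_forall_of_frequently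
    ((not_eventually.1 hcon).and_eventually (isOpen_paramSpace.eventually_mem hp₀))
  have hbad : ∀ n, ∃ α, IsMaximizer α (p n) ∧ (α, p n) ∉ N := fun n => by
    simpa using (hp n).1
  choose α hα hαN using hbad
  have hω₀ := log_one_add_pos hp₀.1
  have hωlim : Tendsto (fun n => Real.log (1 + (p n).1)) atTop (𝓝 (Real.log (1 + p₀.1))) :=
    (continuousAt_log_one_add hp₀.1).tendsto.comp ((continuous_fst.tendsto p₀).comp hlim)
  have hβlim : Tendsto (fun n => (p n).2) atTop (𝓝 p₀.2) := (continuous_snd.tendsto p₀).comp hlim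
  have hbox : ∀ᶠ n in atTop, α n ∈ Set.Icc 0 (Real.log (1 + p₀.1) + p₀.2 + 2) := by
    filter_upwards [hωlim.eventually (gt_mem_nhds (lt_add_one _)),
      hβlim.eventually (gt_mem_nhds (lt_add_one _))] with n h1 h2
    have hω := log_one_add_pos (hp n).2.1
    refine ⟨(hω.trans (hα n).lt).le, ?_⟩
    have h3 := two_sqrt_le_fluxF hω (hα n).lt.le
    rw [(hα n).fluxF_eq] at h3
    have h4 : α n - Real.log (1 + (p n).1) ≤ (p n).2 :=
      (Real.sqrt_le_sqrt_iff (hp n).2.2.le).1 (by linarith)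
    linarith
  obtain ⟨x, -, φ, hφ, hx⟩ := isCompact_Icc.tendsto_subseq' hbox.frequently
  have hωφ := hωlim.comp hφ.tendsto_atTop
  have hle : Real.log (1 + p₀.1) ≤ x :=
    le_of_tendsto_of_tendsto' hωφ hx fun n => (hα (φ n)).lt.le
  have hFlim : Tendsto (fun n => fluxF (α (φ n)) (Real.log (1 + (p (φ n)).1))) atTop
      (𝓝 (fluxF x (Real.log (1 + p₀.1)))) :=
    (continuousAt_fluxF (p := (x, Real.log (1 + p₀.1))) (hω₀.trans_le hle) hω₀).tendsto.comp
      (hx.prodMk_nhds hωφ)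
  have hFlim' : Tendsto (fun n => fluxF (α (φ n)) (Real.log (1 + (p (φ n)).1))) atTop
      (𝓝 (2 * √p₀.2)) := by
    simp_rw [fun n => (hα n).fluxF_eq]
    exact ((Real.continuous_sqrt.tendsto _).comp (hβlim.comp hφ.tendsto_atTop)).const_mul 2
  have hF := tendsto_nhds_unique hFlim hFlim'
  -- The limit cannot lie on the diagonal, where `F` vanishes while `2√β` does not.
  have hlt : Real.log (1 + p₀.1) < x := by
    refine lt_of_le_of_ne hle fun heq => ?_
    rw [← heq, fluxF_self] at hF
    have := Real.sqrt_pos.2 hp₀.2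
    linarith
  have hxα := huniq x hlt hF
  rw [hxα] at hx
  have hmem := (hx.prodMk_nhds (hlim.comp hφ.tendsto_atTop)).eventually hN
  obtain ⟨n, hn⟩ := hmem.exists
  exact hαN (φ n) hn

/-! ### The action as a function of `(α, (ρ, β))` -/

/-- The domain of smoothness of the action. -/
def actionDomain : Set (ℝ × ℝ × ℝ) := {x | x.2 ∈ paramSpace ∧ Real.log (1 + x.2.1) < x.1}

/-- The action in the original parameters. -/
noncomputable def act (x : ℝ × ℝ × ℝ) : ℝ := action x.1 (Real.log (1 + x.2.1)) x.2.2

/-- The residual of the flux equation. -/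
noncomputable def fluxResidual (x : ℝ × ℝ × ℝ) : ℝ := fluxF x.1 (Real.log (1 + x.2.1)) - 2 * √x.2.2

/-- The partial derivatives of the action in the parameters. -/
noncomputable def actPartial (j : Fin 2) (x : ℝ × ℝ × ℝ) : ℝ :=
  ![√(x.1 - Real.log (1 + x.2.1)) / (x.2.1 * √x.2.2),
    fluxK x.1 (Real.log (1 + x.2.1)) / (2 * (x.2.2 * √x.2.2))] j

lemma analyticAt_log_one_add {x : ℝ × ℝ × ℝ} (hx : 0 < x.2.1) :
    AnalyticAt ℝ (fun x : ℝ × ℝ × ℝ => Real.log (1 + x.2.1)) x :=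
  (Real.contDiffAt_log (n := ⊤).2 (by linarith : 1 + x.2.1 ≠ 0)).analyticAt.comp
    (f := fun x : ℝ × ℝ × ℝ => 1 + x.2.1)
    (analyticAt_const.add (analyticAt_fst.comp analyticAt_snd))

lemma analyticAt_sqrt_snd {x : ℝ × ℝ × ℝ} (hx : 0 < x.2.2) :
    AnalyticAt ℝ (fun x : ℝ × ℝ × ℝ => √x.2.2) x :=
  (Real.contDiffAt_sqrt (n := ⊤) hx.ne').analyticAt.comp
    (f := fun x : ℝ × ℝ × ℝ => x.2.2) (analyticAt_snd.comp analyticAt_snd)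

lemma analyticAt_fluxCoord {x : ℝ × ℝ × ℝ} (hx : 0 < x.2.1) :
    AnalyticAt ℝ (fun x : ℝ × ℝ × ℝ => (x.1, Real.log (1 + x.2.1))) x :=
  analyticAt_fst.prod (analyticAt_log_one_add hx)

lemma analyticAt_fluxK_param {x : ℝ × ℝ × ℝ} (hx : x ∈ actionDomain) :
    AnalyticAt ℝ (fun x : ℝ × ℝ × ℝ => fluxK x.1 (Real.log (1 + x.2.1))) x :=
  (analyticAt_fluxK (p := (x.1, Real.log (1 + x.2.1))) (log_one_add_pos hx.1.1) hx.2).comp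
    (f := fun x : ℝ × ℝ × ℝ => (x.1, Real.log (1 + x.2.1))) (analyticAt_fluxCoord hx.1.1)

lemma analyticAt_fluxF_param {x : ℝ × ℝ × ℝ} (hx : x ∈ actionDomain) :
    AnalyticAt ℝ (fun x : ℝ × ℝ × ℝ => fluxF x.1 (Real.log (1 + x.2.1))) x :=
  (analyticAt_fluxF (p := (x.1, Real.log (1 + x.2.1))) (log_one_add_pos hx.1.1) hx.2).comp
    (f := fun x : ℝ × ℝ × ℝ => (x.1, Real.log (1 + x.2.1))) (analyticAt_fluxCoord hx.1.1)

lemma analyticAt_act {x : ℝ × ℝ × ℝ} (hx : x ∈ actionDomain) : AnalyticAt ℝ act x :=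
  analyticAt_fst.sub ((analyticAt_fluxK_param hx).div (analyticAt_sqrt_snd hx.1.2)
    (Real.sqrt_pos.2 hx.1.2).ne')

lemma analyticAt_fluxResidual {x : ℝ × ℝ × ℝ} (hx : x ∈ actionDomain) : AnalyticAt ℝ fluxResidual x :=
  (analyticAt_fluxF_param hx).sub (analyticAt_const.mul (analyticAt_sqrt_snd hx.1.2))

lemma analyticAt_actPartial {x : ℝ × ℝ × ℝ} (hx : x ∈ actionDomain) (j : Fin 2) :
    AnalyticAt ℝ (actPartial j) x := by
  have hρ := hx.1.1
  have hβ := hx.1.2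
  have hs := Real.sqrt_pos.2 hβ
  have h2 : AnalyticAt ℝ (fun x : ℝ × ℝ × ℝ => x.2.1) x := analyticAt_fst.comp analyticAt_snd
  have h3 : AnalyticAt ℝ (fun x : ℝ × ℝ × ℝ => x.2.2) x := analyticAt_snd.comp analyticAt_snd
  fin_cases j
  · exact ((analyticAt_sqrt_sub (p := (x.1, Real.log (1 + x.2.1))) hx.2).comp
      (f := fun x : ℝ × ℝ × ℝ => (x.1, Real.log (1 + x.2.1))) (analyticAt_fluxCoord hρ)).div
      (h2.mul (analyticAt_sqrt_snd hβ)) (mul_pos hρ hs).ne'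
  · exact (analyticAt_fluxK_param hx).div (analyticAt_const.mul (h3.mul (analyticAt_sqrt_snd hβ)))
      (by positivity)

lemma wt_log_one_add {ρ : ℝ} (hρ : 0 < ρ) : wt (Real.log (1 + ρ)) = (1 + ρ) / ρ := by
  rw [wt, Real.exp_neg, exp_log_one_add hρ]
  have : (1 : ℝ) - (1 + ρ)⁻¹ = ρ / (1 + ρ) := by
    field_simp
    ring
  rw [this, inv_div]

lemma hasDerivAt_log_one_add {ρ : ℝ} (hρ : 0 < ρ) :
    HasDerivAt (fun ρ => Real.log (1 + ρ)) (1 / (1 + ρ)) ρ :=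
  ((hasDerivAt_id ρ).const_add 1).log (by simp; linarith)

lemma hasDerivAt_act_param {x : ℝ × ℝ × ℝ} (hx : x ∈ actionDomain) (j : Fin 2) :
    HasLineDerivAt ℝ act (actPartial j x) x (0, coordDir j) := by
  obtain ⟨α, ρ, β⟩ := x
  obtain ⟨⟨hρ, hβ⟩, hα⟩ := hx
  simp only at hρ hβ hα
  have hs := Real.sqrt_pos.2 hβ
  fin_cases j
  · have h := ((hasDerivAt_fluxK_right (log_one_add_pos hρ) hα).comp ρ
      (hasDerivAt_log_one_add hρ)).div_const (√β) |>.const_sub α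
    rw [wt_log_one_add hρ] at h
    have h' := HasDerivAt.comp_const_add ρ 0 (by simpa using h)
    have hval : actPartial 0 (α, ρ, β) = -(-((1 + ρ) / ρ * √(α - Real.log (1 + ρ))) *
        (1 / (1 + ρ)) / √β) := by
      have : 1 + ρ ≠ 0 := by linarith
      simp only [actPartial, Matrix.cons_val_zero]
      field_simp
    simp only [HasLineDerivAt, coordDir]
    change HasDerivAt _ (actPartial 0 (α, ρ, β)) 0
    rw [hval]
    convert! h' using 1
    · ext t
      simp [act, action]
    · simp
  · have h := (((Real.hasDerivAt_sqrt hβ.ne').inv hs.ne').const_mul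
      (fluxK α (Real.log (1 + ρ)))).const_sub α
    have h' := HasDerivAt.comp_const_add β 0 (by simpa using h)
    have hval : actPartial 1 (α, ρ, β) = -(fluxK α (Real.log (1 + ρ)) *
        (-(1 / (2 * √β)) / √β ^ 2)) := by
      simp only [actPartial, Matrix.cons_val_one, Matrix.cons_val_fin_one]
      rw [Real.sq_sqrt hβ.le]
      field_simp
    simp only [HasLineDerivAt, coordDir]
    change HasDerivAt _ (actPartial 1 (α, ρ, β)) 0
    rw [hval]
    convert! h' using 1
    · ext t
      simp [act, action, div_eq_mul_inv]
    · simp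

lemma hasLineDerivAt_actPartial_fst {x : ℝ × ℝ × ℝ} (hx : x ∈ actionDomain) (j : Fin 2) :
    ∃ c, 0 < c ∧ HasLineDerivAt ℝ (actPartial j) c x (1, 0) := by
  obtain ⟨α, ρ, β⟩ := x
  obtain ⟨⟨hρ, hβ⟩, hα⟩ := hx
  simp only at hρ hβ hα
  have hs := Real.sqrt_pos.2 hβ
  have hL := Real.sqrt_pos.2 (sub_pos.2 hα)
  fin_cases j
  · refine ⟨1 / (2 * √(α - Real.log (1 + ρ))) / (ρ * √β), by positivity, ?_⟩
    have h := (hasDerivAt_sqrt_sub_left hα).div_const (ρ * √β)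
    have h' := HasDerivAt.comp_const_add α 0 (by simpa only [add_zero] using h)
    simp only [HasLineDerivAt]
    convert! h' using 1
    ext t
    simp [actPartial]
  · have hF := fluxF_pos (log_one_add_pos hρ) hα
    refine ⟨fluxF α (Real.log (1 + ρ)) / 2 / (2 * (β * √β)), by positivity, ?_⟩
    have h := (hasDerivAt_fluxK_left (log_one_add_pos hρ) hα).div_const (2 * (β * √β))
    have h' := HasDerivAt.comp_const_add α 0 (by simpa only [add_zero] using h)
    simp only [HasLineDerivAt]
    convert! h' using 1
    ext t
    simp [actPartial]

lemma hasLineDerivAt_fluxResidual_fst {x : ℝ × ℝ × ℝ} (hx : x ∈ actionDomain) :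
    HasLineDerivAt ℝ fluxResidual (fluxG x.1 (Real.log (1 + x.2.1))) x (1, 0) := by
  obtain ⟨α, ρ, β⟩ := x
  obtain ⟨⟨hρ, hβ⟩, hα⟩ := hx
  simp only at hρ hβ hα
  have h := (hasDerivAt_fluxF_left (log_one_add_pos hρ) hα).sub_const (2 * √β)
  have h' := HasDerivAt.comp_const_add α 0 (by simpa only [add_zero] using h)
  simp only [HasLineDerivAt]
  convert! h' using 1
  ext t
  simp [fluxResidual]

lemma hasLineDerivAt_fluxResidual_param {x : ℝ × ℝ × ℝ} (hx : x ∈ actionDomain) (j : Fin 2) :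
    ∃ c, c < 0 ∧ HasLineDerivAt ℝ fluxResidual c x (0, coordDir j) := by
  obtain ⟨α, ρ, β⟩ := x
  obtain ⟨⟨hρ, hβ⟩, hα⟩ := hx
  simp only at hρ hβ hα
  have hs := Real.sqrt_pos.2 hβ
  have hL := Real.sqrt_pos.2 (sub_pos.2 hα)
  have hw := wt_pos (log_one_add_pos hρ)
  fin_cases j
  · refine ⟨-wt (Real.log (1 + ρ)) / √(α - Real.log (1 + ρ)) * (1 / (1 + ρ)), ?_, ?_⟩
    · exact mul_neg_of_neg_of_pos (div_neg_of_neg_of_pos (neg_neg_of_pos hw) hL) (by positivity)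
    · have h := ((hasDerivAt_fluxF_right (log_one_add_pos hρ) hα).comp ρ
        (hasDerivAt_log_one_add hρ)).sub_const (2 * √β)
      have h' := HasDerivAt.comp_const_add ρ 0 (by simpa only [add_zero] using h)
      simp only [HasLineDerivAt]
      convert! h' using 1
      ext t
      simp [fluxResidual, coordDir, Function.comp]
  · refine ⟨-(2 * (1 / (2 * √β))), by simp; positivity, ?_⟩
    have h := ((Real.hasDerivAt_sqrt hβ.ne').const_mul 2).const_sub (fluxF α (Real.log (1 + ρ)))
    have h' := HasDerivAt.comp_const_add β 0 (by simpa only [add_zero] using h)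
    simp only [HasLineDerivAt]
    convert! h' using 1
    ext t
    simp [fluxResidual, coordDir]

lemma isOpen_actionDomain : IsOpen actionDomain := by
  have h1 : IsOpen {x : ℝ × ℝ × ℝ | x.2 ∈ paramSpace} := isOpen_paramSpace.preimage continuous_snd
  rw [isOpen_iff_mem_nhds]
  intro x hx
  have hc : ContinuousAt (fun x : ℝ × ℝ × ℝ => Real.log (1 + x.2.1)) x :=
    (analyticAt_log_one_add hx.1.1).continuousAt
  filter_upwards [h1.mem_nhds hx.1, hc.eventually_lt continuousAt_fst hx.2] with y hy1 hy2
  exact ⟨hy1, hy2⟩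

/-! ### Growth of a function along the zero set of another one -/

/-- If `E` vanishes at `(α, p)` and at `(α', p + t v)` with `α ≤ α'`, close to a point where the
derivative of `E` vanishes in the first coordinate and is negative along `v`, then a function
increasing in the first coordinate grows arbitrarily fast from `(α, p)` to `(α', p + t v)`. -/
lemma eventually_steep_growth {V : Type*} [NormedAddCommGroup V] [NormedSpace ℝ V]
    {E d : ℝ × V → ℝ} {E' d' : ℝ × V →L[ℝ] ℝ} {x : ℝ × V} {v : V}
    (hE : HasStrictFDerivAt E E' x) (hd : HasStrictFDerivAt d d' x) (hv : ‖v‖ ≤ 1)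
    (hE1 : E' (1, 0) = 0) (hEv : E' (0, v) < 0) (hd1 : 0 < d' (1, 0)) (M : ℝ) :
    ∃ N ∈ 𝓝 x, ∀ (α α' t : ℝ) (p : V), (α, p) ∈ N → (α', p + t • v) ∈ N → 0 < t → α ≤ α' →
      E (α, p) = 0 → E (α', p + t • v) = 0 → M * t ≤ d (α', p + t • v) - d (α, p) := by
  set c := d' (1, 0)
  set g := d' (0, v)
  set e := -E' (0, v) with he
  have he0 : 0 < e := neg_pos.2 hEv
  -- If `α' - α ≥ M' t`, the linearization of `d` with error `c/2` gives growth of at least `M t`.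
  -- The tolerance `ε` is chosen so that vanishing of `E` at both points forces this: `e t` must be
  -- compensated by the error `ε (α' - α + t)`.
  set M' := 2 * (M - g + c / 2) / c with hM'
  set ε := e / (|M'| + 1) with hε
  have hε0 : 0 < ε := by positivity
  have h1 := (Asymptotics.isLittleO_iff.1 hE.isLittleO) hε0
  have h2 := (Asymptotics.isLittleO_iff.1 hd.isLittleO) (half_pos hd1)
  rw [nhds_prod_eq] at h1 h2
  obtain ⟨N₁, hN₁, h1⟩ := mem_prod_same_iff.1 h1
  obtain ⟨N₂, hN₂, h2⟩ := mem_prod_same_iff.1 h2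
  refine ⟨N₁ ∩ N₂, inter_mem hN₁ hN₂, fun α α' t p hp hp' ht hα hEp hEp' => ?_⟩
  have hdiff : (α', p + t • v) - (α, p) = (α' - α) • ((1 : ℝ), (0 : V)) + t • ((0 : ℝ), v) := by
    simp
  have hnorm : ‖(α', p + t • v) - (α, p)‖ ≤ (α' - α) + t := by
    rw [hdiff]
    refine (norm_add_le _ _).trans (add_le_add ?_ ?_)
    · rw [norm_smul, Real.norm_of_nonneg (sub_nonneg.2 hα)]
      simp [Prod.norm_def]
    · rw [norm_smul, Real.norm_of_nonneg ht.le]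
      simp only [Prod.norm_def, norm_zero]
      rw [max_eq_right (norm_nonneg v)]
      exact mul_le_of_le_one_right ht.le hv
  have k1 := h1 (Set.mk_mem_prod hp'.1 hp.1)
  have k2 := h2 (Set.mk_mem_prod hp'.2 hp.2)
  simp only [Set.mem_ofPred_eq] at k1 k2
  rw [hEp, hEp', hdiff, map_add, map_smul, map_smul, hE1, ← hdiff] at k1
  rw [hdiff, map_add, map_smul, map_smul, ← hdiff] at k2
  simp only [smul_eq_mul] at k1 k2
  replace k1 := (le_abs_self _).trans (k1.trans (mul_le_mul_of_nonneg_left hnorm hε0.le))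
  replace k2 := (neg_le_abs _).trans (k2.trans (mul_le_mul_of_nonneg_left hnorm (half_pos hd1).le))
  have k3 : e * t ≤ ε * (α' - α + t) := by
    rw [he]
    linarith
  have k4 : (|M'| + 1) * t ≤ α' - α + t := by
    rw [hε, div_mul_eq_mul_div, le_div_iff₀ (by positivity)] at k3
    have : e * ((|M'| + 1) * t) ≤ e * (α' - α + t) := by linarith
    exact le_of_mul_le_mul_left this he0
  have k5 : M' * t ≤ α' - α := by
    have := mul_le_mul_of_nonneg_right (le_abs_self M') ht.le
    linarith
  have k6 : c / 2 * (M' * t) = (M - g + c / 2) * t := by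
    rw [hM']
    field_simp
  have k7 := mul_le_mul_of_nonneg_left k5 (half_pos hd1).le
  change _ ≤ c / 2 * _ at k2
  linarith

/-! ### Iterated partial derivatives and phases of a function -/

lemma tendsto_add_smul (p v : ℝ × ℝ) : Tendsto (fun t : ℝ => p + t • v) (𝓝 0) (𝓝 p) :=
  Continuous.tendsto' (by fun_prop) _ _ (by simp)

lemma analyticOnNhd_iterPartial {f : ℝ × ℝ → ℝ} {V : Set (ℝ × ℝ)} (hV : IsOpen V)
    (hVp : V ⊆ paramSpace) (hf : AnalyticOnNhd ℝ f V) (w : List (Fin 2)) :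
    V ⊆ partialDomain f w ∧ AnalyticOnNhd ℝ (iterPartial f w) V := by
  induction w with
  | nil => exact ⟨hVp, hf⟩
  | cons i w ih =>
    refine ⟨fun p hp => ⟨?_, ?_⟩, fun p hp => ?_⟩
    · filter_upwards [(tendsto_add_smul p (coordDir i)).eventually (hV.mem_nhds hp)] with t ht
      exact ih.1 ht
    · exact (ih.2 p hp).differentiableAt.lineDifferentiableAt
    · have h : AnalyticAt ℝ (fun q => fderiv ℝ (iterPartial f w) q (coordDir i)) p :=
        ((ContinuousLinearMap.apply ℝ ℝ (coordDir i)).analyticAt _).comp (ih.2 p hp).fderiv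
      refine h.congr ?_
      filter_upwards [hV.mem_nhds hp] with q hq
      exact (ih.2 q hq).differentiableAt.lineDeriv_eq_fderiv.symm

lemma partialContinuousAt_of_analyticAt {f : ℝ × ℝ → ℝ} {p : ℝ × ℝ} (hp : p ∈ paramSpace)
    (hf : AnalyticAt ℝ f p) (w : List (Fin 2)) : PartialContinuousAt f w p := by
  have hmem : {q | q ∈ paramSpace ∧ AnalyticAt ℝ f q} ∈ 𝓝 p :=
    (isOpen_paramSpace.eventually_mem hp).and hf.eventually_analyticAt
  have h := analyticOnNhd_iterPartial (V := interior {q | q ∈ paramSpace ∧ AnalyticAt ℝ f q})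
    isOpen_interior (fun q hq => (interior_subset hq).1) (fun q hq => (interior_subset hq).2) w
  have hp' := mem_interior_iff_mem_nhds.2 hmem
  exact ⟨h.1 hp', (h.2 p hp').continuousAt.continuousWithinAt⟩

lemma PartialTendstoTop.not_partialContinuousAt {f : ℝ × ℝ → ℝ} {w : List (Fin 2)} {p : ℝ × ℝ}
    (h : PartialTendstoTop f w p) : ¬ PartialContinuousAt f w p := fun hc => by
  have : (𝓝[partialDomain f w] p).NeBot := mem_closure_iff_nhdsWithin_neBot.1 h.1
  exact not_tendsto_nhds_of_tendsto_atTop h.2 _ hc.2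

/-- A point at which `f` is not analytic, and which adheres to a connected set on which `f` is
analytic, is a boundary point of a phase. -/
lemma exists_isPhase_frontier {f : ℝ × ℝ → ℝ} {V : Set (ℝ × ℝ)} {p : ℝ × ℝ}
    (hV : IsPreconnected V) (hVp : V ⊆ paramSpace) (hf : AnalyticOnNhd ℝ f V)
    (hp : p ∈ closure V) (hnot : ¬ AnalyticAt ℝ f p) : ∃ U, IsPhase f U ∧ p ∈ frontier U := by
  set A : Set (ℝ × ℝ) := {q | q ∈ paramSpace ∧ AnalyticAt ℝ f q} with hA
  obtain ⟨x, hx⟩ : V.Nonempty := closure_nonempty_iff.1 ⟨p, hp⟩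
  have hVA : V ⊆ A := fun q hq => ⟨hVp hq, hf q hq⟩
  have hUA : connectedComponentIn A x ⊆ A := connectedComponentIn_subset A x
  refine ⟨connectedComponentIn A x, ⟨⟨fun q hq => (hUA hq).1,
    isConnected_connectedComponentIn_iff.2 (hVA hx), fun q hq => (hUA hq).2⟩, ?_⟩, ?_⟩
  · rintro U ⟨h1, h2, h3⟩ hle
    exact h2.isPreconnected.subset_connectedComponentIn (hle (mem_connectedComponentIn (hVA hx)))
      fun q hq => ⟨h1 hq, h3 q hq⟩
  · exact ⟨closure_mono (hV.subset_connectedComponentIn hx hVA) hp,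
      fun hint => hnot (hUA (interior_subset hint)).2⟩

/-! ### The value function -/

/-- `val` is the maximum of the action at every point of the parameter space. -/
def IsValue (val : ℝ × ℝ → ℝ) : Prop :=
  ∀ p ∈ paramSpace, ∀ α, IsMaximizer α p → val p = act (α, p)

lemma IsMaximizer.mem_actionDomain {α : ℝ} {p : ℝ × ℝ} (h : IsMaximizer α p)
    (hp : p ∈ paramSpace) : (α, p) ∈ actionDomain := ⟨hp, h.lt⟩

lemma IsMaximizer.fluxResidual_eq_zero {α : ℝ} {p : ℝ × ℝ} (h : IsMaximizer α p) :
    fluxResidual (α, p) = 0 := sub_eq_zero.2 h.fluxF_eq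

lemma IsValue.act_le {val : ℝ × ℝ → ℝ} (hval : IsValue val) {x : ℝ × ℝ × ℝ}
    (hx : x ∈ actionDomain) : act x ≤ val x.2 := by
  obtain ⟨α, hα⟩ := exists_isMaximizer hx.1
  rw [hval x.2 hx.1 α hα]
  exact hα.le_action x.1 hx.2.le

lemma tendsto_mk_add_smul (α : ℝ) (p v : ℝ × ℝ) :
    Tendsto (fun t : ℝ => (α, p + t • v)) (𝓝 0) (𝓝 (α, p)) :=
  Continuous.tendsto' (by fun_prop) _ _ (by simp)

/-- Envelope theorem: `val - act (α, ·)` is nonnegative near `p` and zero at `p`, so its derivative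
vanishes there whenever it exists. The maximizer need not be unique. -/
lemma IsValue.lineDeriv_eq {val : ℝ × ℝ → ℝ} (hval : IsValue val) {α : ℝ} {p : ℝ × ℝ}
    (hp : p ∈ paramSpace) (hα : IsMaximizer α p) {j : Fin 2}
    (hd : LineDifferentiableAt ℝ val p (coordDir j)) :
    lineDeriv ℝ val p (coordDir j) = actPartial j (α, p) := by
  have h1 : HasDerivAt (fun t : ℝ => val (p + t • coordDir j)) (lineDeriv ℝ val p (coordDir j)) 0 :=
    hd.hasLineDerivAt
  have h2 := hasDerivAt_act_param (hα.mem_actionDomain hp) j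
  have h3 : (fun t : ℝ => act ((α, p) + t • ((0 : ℝ), coordDir j))) =
      fun t => act (α, p + t • coordDir j) := by ext t; simp
  rw [HasLineDerivAt, h3] at h2
  have hloc : IsLocalMin (fun t : ℝ => val (p + t • coordDir j) - act (α, p + t • coordDir j)) 0 := by
    filter_upwards [(tendsto_mk_add_smul α p (coordDir j)).eventually
      (isOpen_actionDomain.mem_nhds (hα.mem_actionDomain hp))] with t ht
    have ht' : (α, p + t • coordDir j) ∈ actionDomain := ht
    have h4 := hval.act_le ht'
    have h5 := hval p hp α hα
    simp only [zero_smul, add_zero]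
    simp only at h4
    linarith
  have := hloc.hasDerivAt_eq_zero (h1.sub h2)
  linarith

/-- The value function is differentiable where the maximizer is unique. -/
lemma IsValue.hasFDerivAt {val : ℝ × ℝ → ℝ} (hval : IsValue val) {α₀ : ℝ} {p₀ : ℝ × ℝ}
    (hp₀ : p₀ ∈ paramSpace) (hα₀ : IsMaximizer α₀ p₀)
    (huniq : ∀ α, Real.log (1 + p₀.1) < α → fluxF α (Real.log (1 + p₀.1)) = 2 * √p₀.2 → α = α₀) :
    HasFDerivAt val ((fderiv ℝ act (α₀, p₀)).comp (ContinuousLinearMap.inr ℝ ℝ (ℝ × ℝ))) p₀ := by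
  have hx₀ := hα₀.mem_actionDomain hp₀
  have hstrict := (analyticAt_act hx₀).hasStrictFDerivAt
  rw [hasFDerivAt_iff_isLittleO, Asymptotics.isLittleO_iff]
  intro ε hε
  have h1 := Asymptotics.isLittleO_iff.1 hstrict.isLittleO hε
  rw [nhds_prod_eq] at h1
  obtain ⟨N, hN, h1⟩ := mem_prod_same_iff.1 h1
  have hN' : {x : ℝ × ℝ × ℝ | x ∈ N ∧ (x.1, p₀) ∈ N ∧ (α₀, x.2) ∈ N ∧ x ∈ actionDomain ∧
      (x.1, p₀) ∈ actionDomain ∧ (α₀, x.2) ∈ actionDomain} ∈ 𝓝 (α₀, p₀) := by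
    have t1 : Tendsto (fun x : ℝ × ℝ × ℝ => (x.1, p₀)) (𝓝 (α₀, p₀)) (𝓝 (α₀, p₀)) :=
      Continuous.tendsto' (by fun_prop) _ _ rfl
    have t2 : Tendsto (fun x : ℝ × ℝ × ℝ => (α₀, x.2)) (𝓝 (α₀, p₀)) (𝓝 (α₀, p₀)) :=
      Continuous.tendsto' (by fun_prop) _ _ rfl
    have hD := isOpen_actionDomain.mem_nhds hx₀
    filter_upwards [hN, t1 hN, t2 hN, hD, t1 hD, t2 hD] with x a b c d e f
    exact ⟨a, b, c, d, e, f⟩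
  filter_upwards [eventually_isMaximizer_mem hp₀ huniq hN'] with p hp
  obtain ⟨α, hα⟩ := exists_isMaximizer hp.1
  obtain ⟨n1, n2, n3, d1, d2, d3⟩ := hp.2 α hα
  have hN₀ : (α₀, p₀) ∈ N := mem_of_mem_nhds hN
  have k1 := h1 (Set.mk_mem_prod n1 n2)
  have k2 := h1 (Set.mk_mem_prod n3 hN₀)
  have e1 : (α, p) - (α, p₀) = ((0 : ℝ), p - p₀) := by simp
  have e2 : (α₀, p) - (α₀, p₀) = ((0 : ℝ), p - p₀) := by simp
  have e3 : ‖((0 : ℝ), p - p₀)‖ = ‖p - p₀‖ := by simp [Prod.norm_def]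
  simp only [Set.mem_ofPred_eq] at k1 k2
  rw [e1, e3] at k1
  rw [e2, e3] at k2
  have v1 := hval p hp.1 α hα
  have v2 := hval p₀ hp₀ α₀ hα₀
  -- Optimality sandwiches `val p - val p₀` between the increments of the action from `p₀` to `p` at
  -- the fixed heights `α₀` and `α`.
  have v3 := hval.act_le d2
  have v4 := hval.act_le d3
  simp only at v3 v4
  rw [Real.norm_eq_abs, abs_le] at k1 k2 ⊢
  change _ ≤ val p - val p₀ - fderiv ℝ act (α₀, p₀) (0, p - p₀) ∧
    val p - val p₀ - fderiv ℝ act (α₀, p₀) (0, p - p₀) ≤ _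
  constructor <;> linarith [k1.1, k1.2, k2.1, k2.2]

lemma IsValue.partialContinuousAt {val : ℝ × ℝ → ℝ} (hval : IsValue val) {α₀ : ℝ} {p₀ : ℝ × ℝ}
    (hp₀ : p₀ ∈ paramSpace) (hα₀ : IsMaximizer α₀ p₀)
    (huniq : ∀ α, Real.log (1 + p₀.1) < α → fluxF α (Real.log (1 + p₀.1)) = 2 * √p₀.2 → α = α₀)
    {w : List (Fin 2)} (hw : w.length < 2) : PartialContinuousAt val w p₀ := by
  have hf := hval.hasFDerivAt hp₀ hα₀ huniq
  match w, hw with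
  | [], _ => exact ⟨hp₀, hf.continuousAt.continuousWithinAt⟩
  | [j], _ =>
    have hd : LineDifferentiableAt ℝ val p₀ (coordDir j) := hf.differentiableAt.lineDifferentiableAt
    refine ⟨⟨(tendsto_add_smul p₀ _).eventually (isOpen_paramSpace.mem_nhds hp₀), hd⟩, ?_⟩
    have hval₀ : iterPartial val [j] p₀ = actPartial j (α₀, p₀) := hval.lineDeriv_eq hp₀ hα₀ hd
    rw [ContinuousWithinAt, hval₀]
    intro s hs
    have hc := (analyticAt_actPartial (hα₀.mem_actionDomain hp₀) j).continuousAt hs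
    rw [Filter.mem_map]
    filter_upwards [(eventually_isMaximizer_mem hp₀ huniq hc).filter_mono nhdsWithin_le_nhds,
      self_mem_nhdsWithin] with p hp hdom
    obtain ⟨α, hα⟩ := exists_isMaximizer hp.1
    have : iterPartial val [j] p = actPartial j (α, p) := hval.lineDeriv_eq hp.1 hα hdom.2
    rw [Set.mem_preimage, this]
    exact hp.2 α hα

/-- At a degenerate critical point the second-order partial derivatives blow up. -/
lemma IsValue.tendsto_atTop {val : ℝ × ℝ → ℝ} (hval : IsValue val) {α₀ : ℝ} {p₀ : ℝ × ℝ}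
    (hp₀ : p₀ ∈ paramSpace) (hα₀ : IsMaximizer α₀ p₀)
    (huniq : ∀ α, Real.log (1 + p₀.1) < α → fluxF α (Real.log (1 + p₀.1)) = 2 * √p₀.2 → α = α₀)
    (hG : fluxG α₀ (Real.log (1 + p₀.1)) = 0) (i j : Fin 2) :
    Tendsto (iterPartial val [i, j]) (𝓝[partialDomain val [i, j]] p₀) atTop := by
  have hx₀ := hα₀.mem_actionDomain hp₀
  have hE := (analyticAt_fluxResidual hx₀).hasStrictFDerivAt
  have hd := (analyticAt_actPartial hx₀ j).hasStrictFDerivAt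
  have hE1 : fderiv ℝ fluxResidual (α₀, p₀) (1, 0) = 0 := by
    rw [← hG]
    exact (hE.hasFDerivAt.hasLineDerivAt _).unique (hasLineDerivAt_fluxResidual_fst hx₀)
  have hEv : fderiv ℝ fluxResidual (α₀, p₀) (0, coordDir i) < 0 := by
    obtain ⟨c, hc, hl⟩ := hasLineDerivAt_fluxResidual_param hx₀ i
    rw [(hE.hasFDerivAt.hasLineDerivAt _).unique hl]
    exact hc
  have hd1 : 0 < fderiv ℝ (actPartial j) (α₀, p₀) (1, 0) := by
    obtain ⟨c, hc, hl⟩ := hasLineDerivAt_actPartial_fst hx₀ j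
    rw [(hd.hasFDerivAt.hasLineDerivAt _).unique hl]
    exact hc
  have hnorm : ‖coordDir i‖ ≤ 1 := by fin_cases i <;> simp [coordDir, Prod.norm_def]
  rw [Filter.tendsto_atTop]
  intro M
  obtain ⟨N, hN, hgrow⟩ := eventually_steep_growth hE hd hnorm hE1 hEv hd1 M
  have hev := eventually_isMaximizer_mem hp₀ huniq hN
  filter_upwards [hev.eventually_nhds.filter_mono nhdsWithin_le_nhds, self_mem_nhdsWithin]
    with p hp hdom
  have hpp := hp.self_of_nhds
  have hder : HasDerivAt (fun t : ℝ => iterPartial val [j] (p + t • coordDir i))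
      (iterPartial val [i, j] p) 0 := hdom.2.hasLineDerivAt
  have hslope := hasDerivAt_iff_tendsto_slope.1 hder
  -- The derivative is assumed to exist, so slopes with `t > 0` suffice; for these the maximizers
  -- are ordered.
  have hslope' := hslope.mono_left (nhdsWithin_mono 0 (fun t (ht : t ∈ Set.Ioi (0 : ℝ)) => ht.ne'))
  refine ge_of_tendsto hslope' ?_
  have hdom0 := hdom.1.self_of_nhds
  rw [zero_smul, add_zero] at hdom0
  filter_upwards [hdom.1.filter_mono nhdsWithin_le_nhds,
    ((tendsto_add_smul p (coordDir i)).eventually hp).filter_mono nhdsWithin_le_nhds,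
    self_mem_nhdsWithin] with t ht1 ht2 ht3
  have ht : 0 < t := ht3
  obtain ⟨α, hα⟩ := exists_isMaximizer hpp.1
  obtain ⟨α', hα'⟩ := exists_isMaximizer ht2.1
  have hle : α ≤ α' := by
    refine hα.le hpp.1 ht2.1 hα' ?_ ?_ fun heq => ?_
    · fin_cases i <;> simp [coordDir, ht.le]
    · fin_cases i <;> simp [coordDir, ht.le]
    · have h0 : t • coordDir i = 0 := by simpa using heq
      fin_cases i <;> simp [coordDir, ht.ne'] at h0
  have key := hgrow α α' t p (hpp.2 α hα) (ht2.2 α' hα') ht hle hα.fluxResidual_eq_zero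
    hα'.fluxResidual_eq_zero
  have e1 : iterPartial val [j] p = actPartial j (α, p) := hval.lineDeriv_eq hpp.1 hα hdom0.2
  have e2 : iterPartial val [j] (p + t • coordDir i) = actPartial j (α', p + t • coordDir i) :=
    hval.lineDeriv_eq ht2.1 hα' ht1.2
  rw [slope_def_field, zero_smul, add_zero, e1, e2, sub_zero, le_div_iff₀ ht]
  exact key

/-- The value function is analytic where the flux is strictly increasing. -/
lemma IsValue.analyticAt {val : ℝ × ℝ → ℝ} (hval : IsValue val) {p₀ : ℝ × ℝ}
    (hp₀ : p₀ ∈ paramSpace) (hρ : rhoC < p₀.1) : AnalyticAt ℝ val p₀ := by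
  obtain ⟨α₀, hα₀⟩ := exists_isMaximizer hp₀
  set ω₀ := Real.log (1 + p₀.1) with hω₀
  have hω₀pos : 0 < ω₀ := log_one_add_pos hp₀.1
  -- Inverting this map solves the flux equation for `α` with `ω` as a parameter. Its differential
  -- is triangular, and invertible because `fluxG > 0` for `ρ > rhoC`.
  set Θ : ℝ × ℝ → ℝ × ℝ := fun y => (fluxF y.1 y.2, y.2) with hΘ
  have hFan : AnalyticAt ℝ (fun y : ℝ × ℝ => fluxF y.1 y.2) (α₀, ω₀) :=
    analyticAt_fluxF (p := (α₀, ω₀)) hω₀pos hα₀.lt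
  have hΘan : AnalyticAt ℝ Θ (α₀, ω₀) := hFan.prod analyticAt_snd
  set F' := fderiv ℝ (fun y : ℝ × ℝ => fluxF y.1 y.2) (α₀, ω₀) with hF'
  have hG : 0 < F' (1, 0) := by
    rw [hF', ← fluxG_eq_fderiv (p := (α₀, ω₀)) hω₀pos hα₀.lt]
    exact fluxG_pos_of_gt (log_one_add_lt rhoC_pos hρ) hα₀.lt
  have hsplit : ∀ a b : ℝ, F' (a, b) = a * F' (1, 0) + b * F' (0, 1) := by
    intro a b
    have : ((a, b) : ℝ × ℝ) = a • ((1 : ℝ), (0 : ℝ)) + b • ((0 : ℝ), (1 : ℝ)) := by simp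
    rw [this, map_add, map_smul, map_smul, smul_eq_mul, smul_eq_mul]
  let A : ℝ × ℝ →L[ℝ] ℝ × ℝ := F'.prod (ContinuousLinearMap.snd ℝ ℝ ℝ)
  let B : ℝ × ℝ →L[ℝ] ℝ × ℝ := ((F' (1, 0))⁻¹ • (ContinuousLinearMap.fst ℝ ℝ ℝ -
    F' (0, 1) • ContinuousLinearMap.snd ℝ ℝ ℝ)).prod (ContinuousLinearMap.snd ℝ ℝ ℝ)
  let e : (ℝ × ℝ) ≃L[ℝ] ℝ × ℝ := ContinuousLinearEquiv.equivOfInverse A B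
    (fun y => by
      obtain ⟨a, b⟩ := y
      simp only [A, B, ContinuousLinearMap.prod_apply, ContinuousLinearMap.coe_snd', hsplit a b]
      ext
      · simp
        field_simp
        ring
      · simp)
    (fun y => by
      obtain ⟨a, b⟩ := y
      refine Prod.ext ?_ rfl
      change F' ((F' (1, 0))⁻¹ * (a - F' (0, 1) * b), b) = a
      rw [hsplit]
      field_simp
      ring)
  have hΘd : HasStrictFDerivAt Θ (e : ℝ × ℝ →L[ℝ] ℝ × ℝ) (α₀, ω₀) :=
    hFan.hasStrictFDerivAt.prodMk hasStrictFDerivAt_snd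
  have hsymm := (hΘd.toOpenPartialHomeomorph Θ).analyticAt_symm'
    hΘd.mem_toOpenPartialHomeomorph_source hΘan hΘd.hasFDerivAt.fderiv
  set ψ := (hΘd.toOpenPartialHomeomorph Θ).symm with hψ
  change AnalyticAt ℝ ψ (Θ (α₀, ω₀)) at hsymm
  set c : ℝ × ℝ → ℝ × ℝ := fun p => (2 * √p.2, Real.log (1 + p.1)) with hc
  have hcan : AnalyticAt ℝ c p₀ := by
    have h1 : AnalyticAt ℝ (fun p : ℝ × ℝ => √p.2) p₀ :=
      (Real.contDiffAt_sqrt (n := ⊤) hp₀.2.ne').analyticAt.comp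
        (f := fun p : ℝ × ℝ => p.2) analyticAt_snd
    have h2 : AnalyticAt ℝ (fun p : ℝ × ℝ => Real.log (1 + p.1)) p₀ :=
      (Real.contDiffAt_log (n := ⊤).2 (by linarith [hp₀.1] : 1 + p₀.1 ≠ 0)).analyticAt.comp
        (f := fun p : ℝ × ℝ => 1 + p.1) (analyticAt_const.add analyticAt_fst)
    exact (analyticAt_const.mul h1).prod h2
  have hc₀ : c p₀ = Θ (α₀, ω₀) := Prod.ext hα₀.fluxF_eq.symm rfl
  have hψ₀ : ψ (Θ (α₀, ω₀)) = (α₀, ω₀) :=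
    (hΘd.toOpenPartialHomeomorph Θ).left_inv hΘd.mem_toOpenPartialHomeomorph_source
  have hψc : AnalyticAt ℝ (fun p => ψ (c p)) p₀ := by
    rw [← hc₀] at hsymm
    exact hsymm.comp hcan
  have hψc₀ : ψ (c p₀) = (α₀, ω₀) := by rw [hc₀, hψ₀]
  have hlift : AnalyticAt ℝ (fun p => ((ψ (c p)).1, p)) p₀ :=
    (analyticAt_fst.comp hψc).prod analyticAt_id
  have hlift₀ : ((ψ (c p₀)).1, p₀) = (α₀, p₀) := by rw [hψc₀]
  have hact : AnalyticAt ℝ (fun p => act ((ψ (c p)).1, p)) p₀ :=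
    AnalyticAt.comp (g := act) (f := fun p => ((ψ (c p)).1, p))
      (by rw [hlift₀]; exact analyticAt_act (hα₀.mem_actionDomain hp₀)) hlift
  refine hact.congr ?_
  have hright : ∀ᶠ p in 𝓝 p₀, Θ (ψ (c p)) = c p := by
    have := hΘd.eventually_right_inverse
    rw [← hc₀] at this
    exact hcan.continuousAt.eventually this
  have hdom : ∀ᶠ p in 𝓝 p₀, ((ψ (c p)).1, p) ∈ actionDomain :=
    hlift.continuousAt.eventually (show ∀ᶠ y in 𝓝 ((ψ (c p₀)).1, p₀), y ∈ actionDomain by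
      rw [hlift₀]
      exact isOpen_actionDomain.mem_nhds (hα₀.mem_actionDomain hp₀))
  have hgt : ∀ᶠ p : ℝ × ℝ in 𝓝 p₀, rhoC < p.1 :=
    continuous_fst.continuousAt.eventually (lt_mem_nhds hρ)
  filter_upwards [hright, hdom, hgt] with p h1 h2 h3
  obtain ⟨α, hα⟩ := exists_isMaximizer h2.1
  have h4 : (ψ (c p)).2 = Real.log (1 + p.1) := congrArg Prod.snd h1
  have h5 : fluxF (ψ (c p)).1 (ψ (c p)).2 = 2 * √p.2 := congrArg Prod.fst h1
  rw [h4] at h5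
  -- The analytic branch is the maximizer, since the flux equation has only one solution when `ρ ≥
  -- rhoC`.
  rw [hα.unique h3.le h2.2 h5, hval p h2.1 α hα]

/-! ### The main theorem -/

lemma isValue_lyapunov {Ω : Type*} [MeasurableSpace Ω] {P : Measure Ω} {W : ℝ≥0 → Ω → ℝ}
    (hW : IsPreBrownianReal W P) {x₀ : ℝ} (hx₀ : 0 < x₀) {τ : ℕ → ℝ≥0} (hτ : ∀ n, 0 < τ n) :
    IsValue (lyapunov P W x₀ τ) := fun _ hp _ hα =>
  (tendsto_growthRate hW hx₀ hτ hp.1 hp.2 hα.lt.le hα.le_action).limUnder_eq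

lemma isCriticalPair_iff {a β : ℝ} : IsCriticalPair a β ↔
    Real.log rhoC < a ∧ fluxG (softplus a) omegaC = 0 ∧ 0 < β ∧
      fluxF (softplus a) omegaC = 2 * √β := by
  refine and_congr_right fun ha => ?_
  have hd := hasDerivAt_critF rhoC_pos ha
  have hpos : Real.exp a / (1 + Real.exp a) ≠ 0 := by positivity
  rw [critF_eq_fluxF rhoC_pos ha]
  refine and_congr ⟨fun h => ?_, fun h => ?_⟩ (and_congr_right fun _ => eq_comm)
  · exact (mul_eq_zero_iff_right hpos).1 (hd.unique h)
  · change fluxG (softplus a) (Real.log (1 + rhoC)) = 0 at h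
    rwa [h, zero_mul] at hd

lemma exists_isCriticalPair : ∃ a β, IsCriticalPair a β := by
  obtain ⟨α, hα, hG⟩ := exists_fluxG_eq_zero
  obtain ⟨a, rfl⟩ := exists_softplus_eq (omegaC_pos.trans hα)
  have hF := fluxF_pos omegaC_pos hα
  refine ⟨a, (fluxF (softplus a) omegaC / 2) ^ 2, isCriticalPair_iff.2 ⟨?_, hG, by positivity, ?_⟩⟩
  · rw [omegaC, ← softplus_log rhoC_pos] at hα
    exact strictMono_softplus.lt_iff_lt.1 hα
  · rw [Real.sqrt_sq (by positivity)]
    ring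

theorem mainTheorem6 {Ω : Type*} [MeasurableSpace Ω] (P : Measure Ω) (W : ℝ≥0 → Ω → ℝ)
    (hW : IsBrownianReal W P) (x₀ : ℝ) (hx₀ : 0 < x₀) (τ : ℕ → ℝ≥0) (hτ : ∀ n, 0 < τ n) :
    (∀ ρ β : ℝ, 0 < ρ → 0 < β →
      Tendsto (growthRate P W x₀ τ ρ β) atTop (𝓝 (lyapunov P W x₀ τ (ρ, β)))) ∧
    IsLUB decreasingSet rhoC ∧ 0 < rhoC ∧
    (∃ a_c β_c : ℝ, IsCriticalPair a_c β_c) ∧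
    ∀ a_c β_c : ℝ, IsCriticalPair a_c β_c →
      IsPhaseTransition (lyapunov P W x₀ τ) 2 (rhoC, β_c) ∧
      ∀ i j : Fin 2, PartialTendstoTop (lyapunov P W x₀ τ) [i, j] (rhoC, β_c) := by
  have hW' := hW.toIsPreBrownianReal
  have hval := isValue_lyapunov hW' hx₀ hτ
  refine ⟨fun ρ β hρ hβ => ?_, isLUB_rhoC, rhoC_pos, exists_isCriticalPair, fun a β hcrit => ?_⟩
  · obtain ⟨α, hα⟩ := exists_isMaximizer (p := (ρ, β)) ⟨hρ, hβ⟩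
    rw [hval (ρ, β) ⟨hρ, hβ⟩ α hα]
    exact tendsto_growthRate hW' hx₀ hτ hρ hβ hα.lt.le hα.le_action
  obtain ⟨ha, hG, hβ, hF⟩ := isCriticalPair_iff.1 hcrit
  have hp : (rhoC, β) ∈ paramSpace := ⟨rhoC_pos, hβ⟩
  have hlt : omegaC < softplus a := log_one_add_lt_softplus rhoC_pos ha
  -- A maximizer exists and solves the flux equation, whose solution at `rhoC` is unique; so the
  -- degenerate critical point is the global maximizer.
  have hmax : IsMaximizer (softplus a) (rhoC, β) := by
    obtain ⟨α, hα⟩ := exists_isMaximizer hp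
    rwa [hα.unique le_rfl hlt hF]
  have huniq : ∀ α, Real.log (1 + rhoC) < α → fluxF α (Real.log (1 + rhoC)) = 2 * √β →
      α = softplus a := fun α h1 h2 => hmax.unique le_rfl h1 h2
  set V : Set (ℝ × ℝ) := Set.Ioi rhoC ×ˢ Set.Ioi 0 with hV
  have hVp : V ⊆ paramSpace := fun p hp => ⟨rhoC_pos.trans hp.1, hp.2⟩
  have hVan : AnalyticOnNhd ℝ (lyapunov P W x₀ τ) V := fun p hp => hval.analyticAt (hVp hp) hp.1
  have hcl : (rhoC, β) ∈ closure V := by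
    rw [hV, closure_prod_eq, closure_Ioi, closure_Ioi]
    exact ⟨Set.self_mem_Ici, hβ.le⟩
  have htop : ∀ i j : Fin 2, PartialTendstoTop (lyapunov P W x₀ τ) [i, j] (rhoC, β) := fun i j =>
    ⟨closure_mono (analyticOnNhd_iterPartial (isOpen_Ioi.prod isOpen_Ioi) hVp hVan [i, j]).1 hcl,
      hval.tendsto_atTop hp hmax huniq hG i j⟩
  -- The blow-up of one second partial supplies both the required discontinuity and the failure of
  -- analyticity at the critical point.
  have hnot := (htop 0 0).not_partialContinuousAt
  exact ⟨⟨exists_isPhase_frontier ((convex_Ioi _).prod (convex_Ioi _)).isPreconnected hVp hVan hcl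
    fun han => hnot (partialContinuousAt_of_analyticAt hp han _), ⟨[0, 0], rfl, hnot⟩,
    fun w hw => hval.partialContinuousAt hp hmax huniq hw⟩, htop⟩
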